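/- **Setting.** Let $A\in\mathbb R^{n\times d}$ be a nonzero real matrix with rows $a_{(1)},\dots,a_{(n)}\in\mathbb R^d$, singular values $\sigma_1\ge\dots\ge\sigma_d\ge 0$ (and $\sigma_{d+1}=0$), and right singular vectors $v_1,\dots,v_d$, an orthonormal basis of $\mathbb R^d$ with $A^TAv_j=\sigma_j^2v_j$. For $k\ge 1$ let $\kappa_k=\sigma_1^2/\sigma_k^2$, and let $$L^k(i)=\sum_{j=1}^k\frac{(a_{(i)}^Tv_j)^2}{\sigma_j^2},\qquad T^k(i)=\sum_{j=k+1}^d(a_{(i)}^Tv_j)^2$$ be the rank-$k$ leverage score and the rank-$k$ projection distance of row $i$. The matrix is *$(k,\Delta)$-separated* if $\sigma_k^2-\sigma_{k+1}^2\ge\Delta\sigma_1^2$, and *approximately rank-$k$* if $\sum_{j=1}^k\sigma_j^2\ge\frac1{10}\sum_{j=1}^d\sigma_j^2$. **Algorithm** (parameters $k$, $\ell$). First pass: the rows of $A$ are streamed through Frequent Directions with a buffer $B$ of $2\ell$ rows: each row is put into the next free place; whenever the buffer is full, compute $B=U\Sigma V^T$, let $\delta$ be the square of the $\ell$-th largest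 singular value of $B$, and replace $B$ by $\sqrt{\max(\Sigma^2-\delta I,0)}\,V^T$, which frees all but $\ell-1$ places. At the end of the pass the same step is applied once more if the buffer holds at least $\ell$ rows. The result is a sketch $\tilde A$ with at most $\ell$ rows. Then compute singular values $\tilde\sigma_j$ and right singular vectors $\tilde v_j$ of $\tilde A$. Second pass: for each row output $$\tilde L^k(i)=\sum_{j=1}^k\frac{(a_{(i)}^T\tilde v_j)^2}{\tilde\sigma_j^2},\qquad \tilde T^k(i)=\|a_{(i)}\|^2-\sum_{j=1}^k(a_{(i)}^T\tilde v_j)^2 .$$ Resources are counted in exact real arithmetic: memory in real numbers, time in arithmetic operations, where a singular value decomposition of an $m\times d$ matrix is an instruction charged $md\min(m,d)$ operations (up to a constant factor) and $md$ words of work space. **Theorem.** There are a polynomial $p$ in three variables and a constant $C$ such that the following holds for all $n,d$, all $k\ge 1$, all $\Delta>0$ and $\varepsilon>0$, and every nonzero $A\in\mathbb R^{n\times d}$ that is $(k,\Delta)$-separated and approximately rank-$k$. With the sketch size $$\ell=\big\lceil k^2\,p(\varepsilon^{-1},\kappa_k,\Delta^{-1})\big\rceil$$ the algorithm runs to completion,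 and whichever singular vectors its decompositions choose, its estimates satisfy $$|T^k(i)-\tilde T^k(i)|\le\varepsilon\|a_{(i)}\|^2,\qquad |L^k(i)-\tilde L^k(i)|\le\varepsilon k\,\frac{\|a_{(i)}\|^2}{\|A\|_F^2}$$ for every row $i$. The algorithm uses at most $C\,d\ell$ memory and at most $C\,nd\ell$ time. -/

import Mathlib

/-! ### Singular values, singular vectors and the two anomaly scores -/

/-- The `i`-th row of a matrix, as a vector of Euclidean space. -/
def rowVec {n d : ℕ} (A : Matrix (Fin n) (Fin d) ℝ) (i : Fin n) : EuclideanSpace ℝ (Fin d) :=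
  WithLp.toLp 2 (A i)

/-- The `j`-th largest singular value of `A`, counted from `j = 0` and with multiplicity, so that
`sv A 0` is the operator norm `σ₁`. It is `0` for `j ≥ d`. -/
noncomputable def sv {n d : ℕ} (A : Matrix (Fin n) (Fin d) ℝ) (j : ℕ) : ℝ :=
  A.toEuclideanLin.singularValues j

/-- `v` is the right factor of a singular value decomposition `A = U Σ Vᵀ` with singular values in
decreasing order: an orthonormal basis with `Aᵀ A vⱼ = σⱼ² vⱼ`. -/
def IsRightSingularBasis {n d : ℕ} (A : Matrix (Fin n) (Fin d) ℝ)
    (v : OrthonormalBasis (Fin d) ℝ (EuclideanSpace ℝ (Fin d))) : Prop :=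
  ∀ j : Fin d, (A.transpose * A).toEuclideanLin (v j) = (sv A j) ^ 2 • v j

/-- `‖A‖_F²`. -/
def frobSq {n d : ℕ} (A : Matrix (Fin n) (Fin d) ℝ) : ℝ := ∑ i, ∑ j, (A i j) ^ 2

/-- `(k, Δ)`-separation: `σₖ² - σₖ₊₁² ≥ Δ σ₁²`, with `σ_{d+1} = 0`. Used for `k ≥ 1`. -/
def IsSeparated {n d : ℕ} (A : Matrix (Fin n) (Fin d) ℝ) (k : ℕ) (Δ : ℝ) : Prop :=
  Δ * (sv A 0) ^ 2 ≤ (sv A (k - 1)) ^ 2 - (sv A k) ^ 2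

/-- Approximately rank `k`: the top `k` directions carry at least a tenth of the variance. -/
def IsApproxLowRank {n d : ℕ} (A : Matrix (Fin n) (Fin d) ℝ) (k : ℕ) : Prop :=
  (1 / 10 : ℝ) * ∑ j ∈ Finset.range d, (sv A j) ^ 2 ≤ ∑ j ∈ Finset.range k, (sv A j) ^ 2

/-- Condition number `κₖ = σ₁² / σₖ²` of the top `k` subspace. Used for `k ≥ 1`. -/
noncomputable def condNum {n d : ℕ} (A : Matrix (Fin n) (Fin d) ℝ) (k : ℕ) : ℝ :=
  (sv A 0) ^ 2 / (sv A (k - 1)) ^ 2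

/-- Rank-`k` leverage score `Lᵏ(i) = ∑_{j ≤ k} (a₍ᵢ₎ᵀ vⱼ)² / σⱼ²`. -/
noncomputable def leverage {n d : ℕ} (A : Matrix (Fin n) (Fin d) ℝ)
    (v : OrthonormalBasis (Fin d) ℝ (EuclideanSpace ℝ (Fin d))) (k : ℕ) (i : Fin n) : ℝ :=
  ∑ j : Fin d with j.val < k, (inner ℝ (rowVec A i) (v j)) ^ 2 / (sv A j) ^ 2

/-- Rank-`k` projection distance `Tᵏ(i) = ∑_{j > k} (a₍ᵢ₎ᵀ vⱼ)²`. -/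
noncomputable def projDist {n d : ℕ} (A : Matrix (Fin n) (Fin d) ℝ)
    (v : OrthonormalBasis (Fin d) ℝ (EuclideanSpace ℝ (Fin d))) (k : ℕ) (i : Fin n) : ℝ :=
  ∑ j : Fin d with k ≤ j.val, (inner ℝ (rowVec A i) (v j)) ^ 2

/-! ### A row-streaming machine over the reals

The memory consists of row registers, each of which holds a vector of `ℝᵈ` (`d` words), and of scalar
registers, each of which holds one real number (one word). The input can be accessed only by reading
the next row of the current pass; `rewind` starts a new pass. Results are emitted to a write-only
output. Besides arithmetic, there is one instruction for a singular value decomposition, which is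
charged the classical `m d min(m, d)` for an `m × d` matrix, and `m d` words of work space.
Arithmetic is exact. A program is, for each `n`, `d` and each choice of parameters, a finite sequence
of instructions: the control flow depends on these numbers and never on the data. -/

/-- Operations on scalar registers. -/
inductive ScalarOp where
  | add | sub | mul | div | max
  /-- The square root of the first argument. -/
  | sqrt
  /-- The constant zero. -/
  | zero

/-- The value of a scalar operation. -/
noncomputable def ScalarOp.eval : ScalarOp → ℝ → ℝ → ℝ
  | .add, x, y => x + y
  | .sub, x, y => x - y
  | .mul, x, y => x * y
  | .div, x, y => x / y
  | .max, x, y => Max.max x y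
  | .sqrt, x, _ => Real.sqrt x
  | .zero, _, _ => 0

/-- Instructions. -/
inductive Instr where
  /-- Read the next row of the current pass into row register `r`. -/
  | read (r : ℕ)
  /-- Start a new pass over the input. -/
  | rewind
  /-- Decompose the `m × d` matrix `B` held in the row registers `0, …, m - 1`: these are overwritten
  by right singular vectors for the `min(m, d)` largest singular values (and by zeros if `m > d`), the
  scalar registers `0, …, m - 1` by the singular values, in decreasing order. -/
  | svd (m : ℕ)
  /-- Multiply row register `r` by scalar register `s`. -/
  | scale (r s : ℕ)
  /-- Store the inner product of the row registers `r₁`, `r₂` in scalar register `s`. -/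
  | dot (s r₁ r₂ : ℕ)
  /-- Apply a scalar operation to the scalar registers `a`, `b` and store the result in `s`. -/
  | op (o : ScalarOp) (s a b : ℕ)
  /-- Append the pair of scalar registers `a`, `b` to the output. -/
  | emit (a b : ℕ)

/-- Configurations of the machine. -/
structure MState (d : ℕ) where
  /-- Row registers. -/
  rows : ℕ → EuclideanSpace ℝ (Fin d)
  /-- Scalar registers. -/
  scal : ℕ → ℝ
  /-- Number of rows already read in the current pass. -/
  pos : ℕ
  /-- What has been emitted. -/
  out : List (ℝ × ℝ)

/-- Start of a computation: first pass, cleared memory, empty output. -/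
def MState.init (d : ℕ) : MState d where
  rows := fun _ => 0
  scal := fun _ => 0
  pos := 0
  out := []

/-- The `m × d` matrix held in the row registers `0, …, m - 1`. -/
def MState.block {d : ℕ} (s : MState d) (m : ℕ) : Matrix (Fin m) (Fin d) ℝ :=
  Matrix.of fun i j => s.rows i j

/-- The contents of the registers after decomposing `B`, with right singular vectors `b`. -/
noncomputable def MState.afterSVD {d : ℕ} (s : MState d) (m : ℕ)
    (b : OrthonormalBasis (Fin d) ℝ (EuclideanSpace ℝ (Fin d))) : MState d :=
  { s with
    rows := fun r => if r < m then (if h : r < d then b ⟨r, h⟩ else 0) else s.rows r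
    scal := fun r => if r < m then sv (s.block m) r else s.scal r }

/-- One step on input `A`. Singular vectors are not unique: the decomposition may return any choice
of them, possibly a different one at every call. -/
def Step {n d : ℕ} (A : Matrix (Fin n) (Fin d) ℝ) : Instr → MState d → MState d → Prop
  | .read r, s, t => ∃ h : s.pos < n,
      t = { s with rows := Function.update s.rows r (rowVec A ⟨s.pos, h⟩), pos := s.pos + 1 }
  | .rewind, s, t => t = { s with pos := 0 }
  | .svd m, s, t => ∃ b, IsRightSingularBasis (s.block m) b ∧ t = s.afterSVD m b
  | .scale r c, s, t => t = { s with rows := Function.update s.rows r (s.scal c • s.rows r) }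
  | .dot c r₁ r₂, s, t =>
      t = { s with scal := Function.update s.scal c (inner ℝ (s.rows r₁) (s.rows r₂)) }
  | .op o c a b, s, t =>
      t = { s with scal := Function.update s.scal c (o.eval (s.scal a) (s.scal b)) }
  | .emit a b, s, t => t = { s with out := s.out ++ [(s.scal a, s.scal b)] }

/-- `Exec A P s t`: the instruction sequence `P`, started in `s` on input `A`, can end in `t`. -/
def Exec {n d : ℕ} (A : Matrix (Fin n) (Fin d) ℝ) : List Instr → MState d → MState d → Prop
  | [], s, t => t = s
  | c :: P, s, t => ∃ u, Step A c s u ∧ Exec A P u t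

/-- `Produces A P o`: on input `A`, the instruction sequence `P` can produce the output `o`. -/
def Produces {n d : ℕ} (A : Matrix (Fin n) (Fin d) ℝ) (P : List Instr) (o : List (ℝ × ℝ)) : Prop :=
  ∃ t, Exec A P (MState.init d) t ∧ t.out = o

/-- The number of elementary operations that an instruction is charged. -/
def Instr.cost (d : ℕ) : Instr → ℕ
  | .read _ => d
  | .rewind => 1
  | .svd m => m * d * min m d + 1
  | .scale _ _ => d
  | .dot _ _ _ => 2 * d
  | .op _ _ _ _ => 1
  | .emit _ _ => 2

/-- Running time of an instruction sequence on rows of length `d`. -/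
def runTime (d : ℕ) (P : List Instr) : ℕ := (P.map (Instr.cost d)).sum

/-- The number of row registers that must be present: one more than the largest index in use. -/
def Instr.rowRegs : Instr → ℕ
  | .read r => r + 1
  | .svd m => m
  | .scale r _ => r + 1
  | .dot _ r₁ r₂ => max r₁ r₂ + 1
  | _ => 0

/-- The number of scalar registers that must be present. -/
def Instr.scalRegs : Instr → ℕ
  | .svd m => m
  | .scale _ s => s + 1
  | .dot s _ _ => s + 1
  | .op _ s a b => max s (max a b) + 1
  | .emit a b => max a b + 1
  | _ => 0

/-- Temporary work space of an instruction, in words. -/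
def Instr.work (d : ℕ) : Instr → ℕ
  | .svd m => m * d
  | _ => 0

/-- Memory, in words (real numbers), used by an instruction sequence on rows of length `d`. -/
def memory (d : ℕ) (P : List Instr) : ℕ :=
  d * (P.map Instr.rowRegs).foldr max 0 + (P.map Instr.scalRegs).foldr max 0
    + (P.map (Instr.work d)).foldr max 0

/-! ### The two-pass algorithm with Frequent Directions -/

/-- The shrinking step of Frequent Directions on the `m` buffered rows `B`: with `B = U Σ Vᵀ` and
`δ = σ_ℓ²`, replace `B` by `√(max(Σ² - δ I, 0)) Vᵀ`; only the first `ℓ - 1` rows can remain nonzero.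
Used for `1 ≤ ℓ ≤ m ≤ 2 ℓ`. The scalar registers from `2 ℓ` on serve as temporaries. -/
def shrink (ℓ m : ℕ) : List Instr :=
  [.svd m, .op .zero (2 * ℓ) 0 0, .op .mul (2 * ℓ + 1) (ℓ - 1) (ℓ - 1)] ++
  (List.range m).flatMap fun j =>
    [.op .mul (2 * ℓ + 2) j j,
     .op .sub (2 * ℓ + 2) (2 * ℓ + 2) (2 * ℓ + 1),
     .op .max (2 * ℓ + 2) (2 * ℓ + 2) (2 * ℓ),
     .op .sqrt (2 * ℓ + 2) (2 * ℓ + 2) (2 * ℓ + 2),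
     .scale j (2 * ℓ + 2)]

/-- Frequent Directions with a buffer of `2 ℓ` rows, of which `fill` are in use, on the next `n` rows
of the stream: insert each row; when the buffer is full, shrink, which leaves `ℓ - 1` rows. When the
stream ends, a last shrinking step brings the buffer down to a sketch with at most `ℓ` rows. What
follows is passed the number of rows of the sketch. -/
def freqDir (ℓ : ℕ) (andThen : ℕ → List Instr) : (n fill : ℕ) → List Instr
  | 0, fill => (if ℓ ≤ fill then shrink ℓ fill else []) ++ andThen (min fill ℓ)
  | n + 1, fill =>
      .read fill ::
        (if fill + 1 = 2 * ℓ then shrink ℓ (2 * ℓ) ++ freqDir ℓ andThen n (ℓ - 1)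
         else freqDir ℓ andThen n (fill + 1))

/-- Scores of the next row `a` of the stream. With the estimates `vⱼ`, `σⱼ` in row and scalar
register `j`, it emits `(∑_{j < k} (aᵀ vⱼ)² / σⱼ², ‖a‖² - ∑_{j < k} (aᵀ vⱼ)²)`. -/
def scoreRow (ℓ k : ℕ) : List Instr :=
  [.read (2 * ℓ),
   .op .zero (2 * ℓ) 0 0,
   .dot (2 * ℓ + 1) (2 * ℓ) (2 * ℓ)] ++
  ((List.range k).flatMap fun j =>
    [.dot (2 * ℓ + 2) (2 * ℓ) j,
     .op .mul (2 * ℓ + 2) (2 * ℓ + 2) (2 * ℓ + 2),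
     .op .sub (2 * ℓ + 1) (2 * ℓ + 1) (2 * ℓ + 2),
     .op .mul (2 * ℓ + 3) j j,
     .op .div (2 * ℓ + 2) (2 * ℓ + 2) (2 * ℓ + 3),
     .op .add (2 * ℓ) (2 * ℓ) (2 * ℓ + 2)]) ++
  [.emit (2 * ℓ) (2 * ℓ + 1)]

/-- The algorithm on a stream of `n` rows, with sketch size `ℓ`: a first pass with Frequent
Directions, a singular value decomposition of the sketch, and a second pass that emits, for each row,
the estimates of its rank-`k` leverage score and of its rank-`k` projection distance. -/
def twoPassFD (n k ℓ : ℕ) : List Instr :=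
  freqDir ℓ (fun m => .svd m :: .rewind :: (List.replicate n (scoreRow ℓ k)).flatten) n 0

/-! Throughout the first pass the buffer B obeys one invariant (`IsSketch`): for the matrix A of the
rows read so far there is η ≥ 0 with ‖AᵀA - BᵀB‖ ≤ η and ℓη + ‖B‖_F² ≤ ‖A‖_F². Inserting a row
changes neither difference. Shrinking by δ moves the Gram operator by at most δ but costs at least
ℓδ of trace, so η may grow by δ (`IsSketch.shrink`). At the end ℓη ≤ ‖A‖_F², which is at most 10kσ₁²
for an approximately rank-k matrix.

Both scores come from quadratic forms f(AᵀA) with f supported on the top k eigenvalues: f = 1 for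
the projection distance, f(λ) = 1/λ for the leverage score. One estimate, `abs_sum_sub_sum_le`,
serves for both. In the mixed bases of eigenvectors of M and N, the (i, j) entry of f(M) - g(N) is a
divided difference times the (i, j) entry of M - N. Nonzero entries lie in k rows and k columns, and
every row or column of M - N has norm at most η. Weyl's inequality (`eigenvalue_le_add`) keeps the
spectral gap open and so bounds the divided differences (`score_error_le`). One factor k of ℓ comes
from this estimate, the other from ‖A‖_F² ≤ 10kσ₁².

The program is tied to this by a calculus of total correctness (`Runs`) that quantifies over all
choices of singular vectors. Its running time is bounded by amortizing the shrinking steps over the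
buffered rows. -/

/-- The action on `x` of the Gram operator `∑ wᵣ wᵣᵀ` of the vectors `w 0, …, w (m - 1)`. -/
noncomputable def rowGram {d : ℕ} (w : ℕ → EuclideanSpace ℝ (Fin d)) (m : ℕ) :
    EuclideanSpace ℝ (Fin d) →ₗ[ℝ] EuclideanSpace ℝ (Fin d) :=
  ∑ r ∈ Finset.range m, (innerₛₗ ℝ (w r)).smulRight (w r)

/-- The squared Frobenius norm of the vectors `w 0, …, w (m - 1)`. -/
noncomputable def rowMass {d : ℕ} (w : ℕ → EuclideanSpace ℝ (Fin d)) (m : ℕ) : ℝ :=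
  ∑ r ∈ Finset.range m, ‖w r‖ ^ 2

/-- The rows of a matrix as an infinite sequence, continued by zeros. -/
noncomputable def streamRow {n d : ℕ} (A : Matrix (Fin n) (Fin d) ℝ) (r : ℕ) :
    EuclideanSpace ℝ (Fin d) :=
  if h : r < n then rowVec A ⟨r, h⟩ else 0

/-! ### Gram operators and their traces -/

section RowGram

variable {d : ℕ}

lemma rowGram_apply (w : ℕ → EuclideanSpace ℝ (Fin d)) (m : ℕ) (x : EuclideanSpace ℝ (Fin d)) :
    rowGram w m x = ∑ r ∈ Finset.range m, inner ℝ (w r) x • w r := by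
  simp [rowGram]

lemma rowGram_congr {w w' : ℕ → EuclideanSpace ℝ (Fin d)} {m : ℕ} (h : ∀ r < m, w r = w' r) :
    rowGram w m = rowGram w' m :=
  Finset.sum_congr rfl fun r hr => by rw [h r (Finset.mem_range.1 hr)]

lemma rowMass_congr {w w' : ℕ → EuclideanSpace ℝ (Fin d)} {m : ℕ} (h : ∀ r < m, w r = w' r) :
    rowMass w m = rowMass w' m :=
  Finset.sum_congr rfl fun r hr => by rw [h r (Finset.mem_range.1 hr)]

lemma rowGram_succ_apply (w : ℕ → EuclideanSpace ℝ (Fin d)) (m : ℕ)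
    (x : EuclideanSpace ℝ (Fin d)) :
    rowGram w (m + 1) x = rowGram w m x + inner ℝ (w m) x • w m := by
  simp [rowGram_apply, Finset.sum_range_succ]

lemma rowMass_succ (w : ℕ → EuclideanSpace ℝ (Fin d)) (m : ℕ) :
    rowMass w (m + 1) = rowMass w m + ‖w m‖ ^ 2 :=
  Finset.sum_range_succ _ _

lemma rowMass_nonneg (w : ℕ → EuclideanSpace ℝ (Fin d)) (m : ℕ) : 0 ≤ rowMass w m :=
  Finset.sum_nonneg fun _ _ => sq_nonneg _

lemma inner_rowGram (w : ℕ → EuclideanSpace ℝ (Fin d)) (m : ℕ)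
    (x y : EuclideanSpace ℝ (Fin d)) :
    inner ℝ x (rowGram w m y) = ∑ r ∈ Finset.range m, inner ℝ (w r) x * inner ℝ (w r) y := by
  rw [rowGram_apply, inner_sum]
  refine Finset.sum_congr rfl fun r _ => ?_
  rw [real_inner_smul_right, real_inner_comm (w r) x, mul_comm]

lemma rowGram_symm (w : ℕ → EuclideanSpace ℝ (Fin d)) (m : ℕ)
    (x y : EuclideanSpace ℝ (Fin d)) :
    inner ℝ (rowGram w m x) y = inner ℝ x (rowGram w m y) := by
  rw [real_inner_comm, inner_rowGram, inner_rowGram]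
  exact Finset.sum_congr rfl fun r _ => mul_comm _ _

/-- The mass is the trace of the Gram operator: Parseval for each row, then an exchange of sums. -/
lemma rowMass_eq_sum_inner (w : ℕ → EuclideanSpace ℝ (Fin d)) (m : ℕ)
    (b : OrthonormalBasis (Fin d) ℝ (EuclideanSpace ℝ (Fin d))) :
    rowMass w m = ∑ j, inner ℝ (b j) (rowGram w m (b j)) := by
  simp_rw [inner_rowGram]
  rw [Finset.sum_comm]
  refine Finset.sum_congr rfl fun r _ => ?_
  rw [← b.sum_sq_inner_right (w r)]
  exact Finset.sum_congr rfl fun j _ => by rw [real_inner_comm, sq]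

lemma rowGram_eq_sum {w : ℕ → EuclideanSpace ℝ (Fin d)} {m : ℕ}
    {b : OrthonormalBasis (Fin d) ℝ (EuclideanSpace ℝ (Fin d))} {c : Fin d → ℝ}
    (h : ∀ j, rowGram w m (b j) = c j • b j) (x : EuclideanSpace ℝ (Fin d)) :
    rowGram w m x = ∑ j, (c j * inner ℝ (b j) x) • b j := by
  conv_lhs => rw [← b.sum_repr' x]
  rw [map_sum]
  refine Finset.sum_congr rfl fun j _ => ?_
  rw [map_smul, h, smul_smul, mul_comm]

lemma rowMass_eq_sum {w : ℕ → EuclideanSpace ℝ (Fin d)} {m : ℕ}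
    {b : OrthonormalBasis (Fin d) ℝ (EuclideanSpace ℝ (Fin d))} {c : Fin d → ℝ}
    (h : ∀ j, rowGram w m (b j) = c j • b j) : rowMass w m = ∑ j, c j := by
  rw [rowMass_eq_sum_inner w m b]
  refine Finset.sum_congr rfl fun j _ => ?_
  rw [h, real_inner_smul_right, real_inner_self_eq_norm_sq, b.norm_eq_one]
  ring

lemma transpose_mul_self_apply {m : ℕ} (B : Matrix (Fin m) (Fin d) ℝ)
    (x : EuclideanSpace ℝ (Fin d)) :
    (B.transpose * B).toEuclideanLin x = ∑ i, inner ℝ (rowVec B i) x • rowVec B i := by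
  ext j
  simp only [Matrix.toLpLin_apply, ← Matrix.mulVec_mulVec]
  simp [Matrix.mulVec, dotProduct, rowVec, PiLp.inner_apply, Matrix.transpose_apply, mul_comm]

lemma rowGram_streamRow {n : ℕ} (A : Matrix (Fin n) (Fin d) ℝ) :
    rowGram (streamRow A) n = (A.transpose * A).toEuclideanLin := by
  ext1 x
  rw [transpose_mul_self_apply, rowGram_apply,
    ← Fin.sum_univ_eq_sum_range (fun r => inner ℝ (streamRow A r) x • streamRow A r)]
  simp [streamRow]

lemma rowMass_streamRow {n : ℕ} (A : Matrix (Fin n) (Fin d) ℝ) :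
    rowMass (streamRow A) n = frobSq A := by
  rw [rowMass, ← Fin.sum_univ_eq_sum_range (fun r => ‖streamRow A r‖ ^ 2)]
  simp [streamRow, frobSq, EuclideanSpace.norm_sq_eq, rowVec]

lemma rowGram_block (s : MState d) (m : ℕ) :
    rowGram s.rows m = ((s.block m).transpose * s.block m).toEuclideanLin := by
  ext1 x
  rw [transpose_mul_self_apply, rowGram_apply,
    ← Fin.sum_univ_eq_sum_range (fun r => inner ℝ (s.rows r) x • s.rows r)]
  rfl

end RowGram

/-! ### Singular values of a matrix -/

section SingularValues

variable {n d : ℕ} (A : Matrix (Fin n) (Fin d) ℝ)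

lemma sv_nonneg (j : ℕ) : 0 ≤ sv A j := LinearMap.singularValues_nonneg _ _

lemma sv_antitone : Antitone (sv A) := LinearMap.singularValues_antitone _

lemma sv_eq_zero_of_width_le {j : ℕ} (h : d ≤ j) : sv A j = 0 :=
  LinearMap.singularValues_of_finrank_le _ (by simpa using h)

/-- Used to show that a sketch whose k-th singular value is positive has at least k rows. -/
lemma sv_eq_zero_of_height_le {j : ℕ} (h : n ≤ j) : sv A j = 0 := by
  rw [sv, LinearMap.singularValues_eq_zero_iff_le_finrank_range]
  exact (Submodule.finrank_le _).trans (by simpa using h)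

/-- The spectral theorem for AᵀA. It also guarantees that a decomposition instruction never gets
stuck. -/
lemma exists_isRightSingularBasis :
    ∃ v : OrthonormalBasis (Fin d) ℝ (EuclideanSpace ℝ (Fin d)), IsRightSingularBasis A v := by
  have hd : Module.finrank ℝ (EuclideanSpace ℝ (Fin d)) = d := by simp
  refine ⟨A.toEuclideanLin.isSymmetric_adjoint_comp_self.eigenvectorBasis hd, fun j => ?_⟩
  have h : (A.transpose * A).toEuclideanLin
      = LinearMap.adjoint A.toEuclideanLin ∘ₗ A.toEuclideanLin := by
    rw [← Matrix.toEuclideanLin_conjTranspose_eq_adjoint,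
      Matrix.conjTranspose_eq_transpose_of_trivial]
    ext1 x
    simp [Matrix.toLpLin_apply, Matrix.mulVec_mulVec]
  rw [h, LinearMap.IsSymmetric.apply_eigenvectorBasis, sv, LinearMap.sq_singularValues_fin _ hd]
  rfl

lemma frobSq_eq_sum_sv : frobSq A = ∑ j ∈ Finset.range d, sv A j ^ 2 := by
  obtain ⟨v, hv⟩ := exists_isRightSingularBasis A
  rw [← rowMass_streamRow, ← Fin.sum_univ_eq_sum_range (fun j => sv A j ^ 2)]
  refine rowMass_eq_sum (b := v) fun j => ?_
  rw [rowGram_streamRow]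
  exact hv j

lemma frobSq_pos {A : Matrix (Fin n) (Fin d) ℝ} (hA : A ≠ 0) : 0 < frobSq A := by
  have : ∃ i j, A i j ≠ 0 := by
    by_contra! h
    exact hA (by ext i j; exact h i j)
  obtain ⟨i, j, h⟩ := this
  exact Finset.sum_pos' (fun i _ => Finset.sum_nonneg fun j _ => sq_nonneg _)
    ⟨i, Finset.mem_univ _, Finset.sum_pos' (fun j _ => sq_nonneg _)
      ⟨j, Finset.mem_univ _, by positivity⟩⟩

lemma sv_zero_pos {A : Matrix (Fin n) (Fin d) ℝ} (hA : A ≠ 0) : 0 < sv A 0 := by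
  refine (sv_nonneg A 0).lt_of_ne fun h => (frobSq_pos hA).ne' ?_
  rw [frobSq_eq_sum_sv]
  refine Finset.sum_eq_zero fun j _ => ?_
  have h1 := sv_antitone A (Nat.zero_le j)
  rw [le_antisymm (h1.trans h.symm.le) (sv_nonneg A j)]
  norm_num

end SingularValues

/-! ### The Frequent Directions invariant -/

/-- The vectors `w 0, …, w (m - 1)` are a sketch of `u 0, …, u (p - 1)`: the error `η` in operator
norm of the Gram operator is paid for, `ℓ`-fold, by a loss of Frobenius mass. -/
def IsSketch {d : ℕ} (ℓ : ℕ) (u : ℕ → EuclideanSpace ℝ (Fin d)) (p : ℕ)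
    (w : ℕ → EuclideanSpace ℝ (Fin d)) (m : ℕ) : Prop :=
  ∃ η : ℝ, 0 ≤ η ∧ (∀ x, ‖rowGram u p x - rowGram w m x‖ ≤ η * ‖x‖) ∧
    ℓ * η + rowMass w m ≤ rowMass u p

section Sketch

variable {d : ℕ}

lemma isSketch_zero (ℓ : ℕ) (u w : ℕ → EuclideanSpace ℝ (Fin d)) : IsSketch ℓ u 0 w 0 :=
  ⟨0, le_rfl, by simp [rowGram], by simp [rowMass]⟩

lemma IsSketch.congr {ℓ p m : ℕ} {u w w' : ℕ → EuclideanSpace ℝ (Fin d)}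
    (h : IsSketch ℓ u p w m) (hw : ∀ r < m, w r = w' r) : IsSketch ℓ u p w' m := by
  rwa [IsSketch, ← rowGram_congr hw, ← rowMass_congr hw]

/-- The same rank-one term enters both Gram operators and the same squared norm both masses, so η is
kept. -/
lemma IsSketch.insert {ℓ p m : ℕ} {u w : ℕ → EuclideanSpace ℝ (Fin d)}
    (h : IsSketch ℓ u p w m) : IsSketch ℓ u (p + 1) (Function.update w m (u p)) (m + 1) := by
  obtain ⟨η, h0, h1, h2⟩ := h.congr (w' := Function.update w m (u p))
    fun r hr => (Function.update_of_ne hr.ne _ _).symm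
  refine ⟨η, h0, fun x => ?_, ?_⟩
  · simpa [rowGram_succ_apply] using h1 x
  · simp only [rowMass_succ, Function.update_self]
    linarith

lemma sum_range_eq_sum_range {M : Type*} [AddCommMonoid M] {f : ℕ → M} {a b : ℕ}
    (ha : ∀ r, a ≤ r → f r = 0) (hb : ∀ r, b ≤ r → f r = 0) :
    ∑ r ∈ Finset.range a, f r = ∑ r ∈ Finset.range b, f r := by
  rcases le_total a b with h | h
  · exact Finset.sum_subset (Finset.range_mono h) fun r _ hr => ha r (by simpa using hr)
  · exact (Finset.sum_subset (Finset.range_mono h) fun r _ hr => hb r (by simpa using hr)).symm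

lemma norm_sum_smul_le (b : OrthonormalBasis (Fin d) ℝ (EuclideanSpace ℝ (Fin d)))
    {c : Fin d → ℝ} {δ : ℝ} (hc : ∀ j, |c j| ≤ δ) (hδ : 0 ≤ δ) (x : EuclideanSpace ℝ (Fin d)) :
    ‖∑ j, (c j * inner ℝ (b j) x) • b j‖ ≤ δ * ‖x‖ := by
  refine abs_le_of_sq_le_sq' ?_ (by positivity) |>.2
  rw [← b.sum_sq_inner_right, mul_pow, ← b.sum_sq_inner_right x, Finset.mul_sum]
  refine Finset.sum_le_sum fun j _ => ?_
  rw [b.orthonormal.inner_right_fintype, mul_pow]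
  exact mul_le_mul_of_nonneg_right (sq_le_sq' (abs_le.1 (hc j)).1 (abs_le.1 (hc j)).2) (sq_nonneg _)

/-- The rows `√(max(Σ² - δ I, 0)) Vᵀ`. -/
noncomputable def shrunkRow (σ : ℕ → ℝ) (δ : ℝ)
    (b : OrthonormalBasis (Fin d) ℝ (EuclideanSpace ℝ (Fin d))) (r : ℕ) :
    EuclideanSpace ℝ (Fin d) :=
  Real.sqrt (max (σ r * σ r - δ) 0) • (if h : r < d then b ⟨r, h⟩ else 0)

/-- The new Gram operator is diagonal in the same basis, with each σⱼ² lowered by min(σⱼ², δ) ≤ δ;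
the top ℓ eigenvalues lose exactly δ each. Since δ is itself the ℓ-th of them, rows from index ℓ - 1
on vanish, and any number q ≥ ℓ - 1 of rows may be counted. -/
lemma IsSketch.shrink {ℓ p m q : ℕ} {u w : ℕ → EuclideanSpace ℝ (Fin d)} {σ : ℕ → ℝ}
    {b : OrthonormalBasis (Fin d) ℝ (EuclideanSpace ℝ (Fin d))}
    (h : IsSketch ℓ u p w m) (hσ : Antitone σ) (hσ0 : ∀ r, 0 ≤ σ r) (hσd : ∀ r, d ≤ r → σ r = 0)
    (hb : ∀ j : Fin d, rowGram w m (b j) = σ j ^ 2 • b j)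
    (hq : ℓ - 1 ≤ q) :
    IsSketch ℓ u p (shrunkRow σ (σ (ℓ - 1) * σ (ℓ - 1)) b) q := by
  set δ := σ (ℓ - 1) * σ (ℓ - 1) with hδ
  have hδ0 : 0 ≤ δ := mul_self_nonneg _
  have hzero : ∀ r, ℓ - 1 ≤ r → σ r * σ r - δ ≤ 0 := fun r hr =>
    sub_nonpos.2 (mul_self_le_mul_self (hσ0 r) (hσ hr))
  have hw0 : ∀ r, ℓ - 1 ≤ r → shrunkRow σ δ b r = 0 := fun r hr => by
    simp [shrunkRow, max_eq_right (hzero r hr)]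
  have hwd : ∀ r, d ≤ r → shrunkRow σ δ b r = 0 := fun r hr => by
    simp [shrunkRow, hr.not_gt]
  have hG : ∀ x, rowGram (shrunkRow σ δ b) q x
      = ∑ j : Fin d, (max (σ j * σ j - δ) 0 * inner ℝ (b j) x) • b j := by
    intro x
    rw [rowGram_apply, sum_range_eq_sum_range (b := d)
      (fun r hr => by simp [hw0 r (hq.trans hr)]) (fun r hr => by simp [hwd r hr]),
      ← Fin.sum_univ_eq_sum_range
        (fun r => inner ℝ (shrunkRow σ δ b r) x • shrunkRow σ δ b r)]
    refine Finset.sum_congr rfl fun j _ => ?_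
    simp only [shrunkRow, j.isLt, dif_pos, Fin.eta, real_inner_smul_left, smul_smul]
    congr 1
    rw [mul_right_comm, Real.mul_self_sqrt (le_max_right _ _)]
  have hM : rowMass (shrunkRow σ δ b) q = ∑ j : Fin d, max (σ j * σ j - δ) 0 := by
    refine rowMass_eq_sum (b := b) fun j => ?_
    rw [hG, Finset.sum_eq_single j]
    · simp
    · intro i _ hij
      simp [b.inner_eq_zero hij]
    · simp
  obtain ⟨η, h0, h1, h2⟩ := h
  have hmin : ∀ j, |σ j ^ 2 - max (σ j * σ j - δ) 0| ≤ δ := fun j => by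
    rw [abs_le]
    rcases max_cases (σ j * σ j - δ) 0 with ⟨h, h'⟩ | ⟨h, h'⟩ <;> rw [h] <;>
      constructor <;> nlinarith [sq_nonneg (σ j)]
  refine ⟨η + δ, by positivity, fun x => ?_, ?_⟩
  · have h3 : ‖rowGram w m x - rowGram (shrunkRow σ δ b) q x‖ ≤ δ * ‖x‖ := by
      rw [rowGram_eq_sum hb, hG, ← Finset.sum_sub_distrib]
      simp_rw [← sub_smul, ← sub_mul]
      exact norm_sum_smul_le b (fun j => hmin j) hδ0 x
    calc _ = ‖(rowGram u p x - rowGram w m x)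
          + (rowGram w m x - rowGram (shrunkRow σ δ b) q x)‖ := by rw [sub_add_sub_cancel]
      _ ≤ _ := norm_add_le _ _
      _ ≤ _ := by rw [add_mul]; exact add_le_add (h1 x) h3
  · have h4 : ℓ * δ + rowMass (shrunkRow σ δ b) q ≤ rowMass w m := by
      rw [rowMass_eq_sum hb, hM, ← le_sub_iff_add_le, ← Finset.sum_sub_distrib]
      -- With d < ℓ there are not ℓ eigenvalues to charge, but then σ has index at least d and δ =
      -- 0.
      rcases lt_or_ge d ℓ with hdl | hdl
      · have : δ = 0 := by rw [hδ, hσd _ (by omega), mul_zero]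
        rw [this]
        refine le_of_eq_of_le (by simp) (Finset.sum_nonneg fun j _ => ?_)
        rw [sub_zero, max_eq_left (mul_self_nonneg _), sq, sub_self]
      · calc (ℓ : ℝ) * δ = ∑ _j ∈ Finset.range ℓ, δ := by simp
          _ ≤ ∑ j ∈ Finset.range ℓ, (σ j ^ 2 - max (σ j * σ j - δ) 0) := by
            refine Finset.sum_le_sum fun j hj => ?_
            have hj' : j ≤ ℓ - 1 := by have := Finset.mem_range.1 hj; omega
            have := mul_self_le_mul_self (hσ0 _) (hσ hj')
            rw [max_eq_left (by linarith)]
            exact le_of_eq (by ring)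
          _ ≤ ∑ j ∈ Finset.range d, (σ j ^ 2 - max (σ j * σ j - δ) 0) := by
            refine Finset.sum_le_sum_of_subset_of_nonneg (Finset.range_mono hdl) fun j _ _ => ?_
            rw [sub_nonneg]
            exact max_le (by nlinarith) (sq_nonneg _)
          _ = _ := (Fin.sum_univ_eq_sum_range
            (fun j => σ j ^ 2 - max (σ j * σ j - δ) 0) d).symm
    rw [mul_add]
    linarith

end Sketch

/-! ### Total correctness for the nondeterministic machine -/

/-- Started in `s` on input `A`, the instruction sequence `P` can run to its end, and in whatever
configuration it ends, `Q` holds. -/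
def Runs {n d : ℕ} (A : Matrix (Fin n) (Fin d) ℝ) (P : List Instr) (s : MState d)
    (Q : MState d → Prop) : Prop :=
  (∃ t, Exec A P s t) ∧ ∀ t, Exec A P s t → Q t

section Runs

variable {n d : ℕ} {A : Matrix (Fin n) (Fin d) ℝ} {s : MState d} {Q Q' : MState d → Prop}

lemma exec_append {P R : List Instr} {s t : MState d} :
    Exec A (P ++ R) s t ↔ ∃ u, Exec A P s u ∧ Exec A R u t := by
  induction P generalizing s with
  | nil => simp [Exec]
  | cons c P ih =>
    simp only [List.cons_append, Exec, ih]
    constructor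
    · rintro ⟨u, h1, w, h2, h3⟩
      exact ⟨w, ⟨u, h1, h2⟩, h3⟩
    · rintro ⟨w, ⟨u, h1, h2⟩, h3⟩
      exact ⟨u, h1, w, h2, h3⟩

lemma Runs.mono {P : List Instr} (h : Runs A P s Q) (hQ : ∀ t, Q t → Q' t) : Runs A P s Q' :=
  ⟨h.1, fun t ht => hQ t (h.2 t ht)⟩

lemma Runs.nil (h : Q s) : Runs A [] s Q :=
  ⟨⟨s, rfl⟩, fun t ht => by rwa [show t = s from ht]⟩

lemma Runs.append {P R : List Instr} (h : Runs A P s fun u => Runs A R u Q) :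
    Runs A (P ++ R) s Q := by
  obtain ⟨⟨u, hu⟩, h2⟩ := h
  obtain ⟨t, ht⟩ := (h2 u hu).1
  refine ⟨⟨t, exec_append.2 ⟨u, hu, ht⟩⟩, fun t' ht' => ?_⟩
  obtain ⟨u', hu', hut'⟩ := exec_append.1 ht'
  exact (h2 u' hu').2 t' hut'

lemma Runs.cons {c : Instr} {P : List Instr} (h1 : ∃ u, Step A c s u)
    (h2 : ∀ u, Step A c s u → Runs A P u Q) : Runs A (c :: P) s Q := by
  obtain ⟨u, hu⟩ := h1
  obtain ⟨t, ht⟩ := (h2 u hu).1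
  refine ⟨⟨t, u, hu, ht⟩, fun t' ht' => ?_⟩
  obtain ⟨u', hu', hut'⟩ := ht'
  exact (h2 u' hu').2 t' hut'

lemma Runs.cons_eq {c : Instr} {P : List Instr} {u : MState d} (hc : ∀ t, Step A c s t ↔ t = u)
    (h : Runs A P u Q) : Runs A (c :: P) s Q :=
  Runs.cons ⟨u, (hc u).2 rfl⟩ fun t ht => by rwa [(hc t).1 ht]

/-- The one instruction that can block, hence the bound on the position. -/
lemma Runs.read {P : List Instr} {r : ℕ} (hs : s.pos < n)
    (h : Runs A P { s with rows := Function.update s.rows r (streamRow A s.pos),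
                           pos := s.pos + 1 } Q) :
    Runs A (.read r :: P) s Q :=
  Runs.cons_eq (fun t => by simp [Step, streamRow, hs]) h

lemma Runs.rewind {P : List Instr} (h : Runs A P { s with pos := 0 } Q) :
    Runs A (.rewind :: P) s Q :=
  Runs.cons_eq (fun _ => Iff.rfl) h

lemma Runs.scale {P : List Instr} {r c : ℕ}
    (h : Runs A P { s with rows := Function.update s.rows r (s.scal c • s.rows r) } Q) :
    Runs A (.scale r c :: P) s Q :=
  Runs.cons_eq (fun _ => Iff.rfl) h

lemma Runs.dot {P : List Instr} {c r₁ r₂ : ℕ}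
    (h : Runs A P
      { s with scal := Function.update s.scal c (inner ℝ (s.rows r₁) (s.rows r₂)) } Q) :
    Runs A (.dot c r₁ r₂ :: P) s Q :=
  Runs.cons_eq (fun _ => Iff.rfl) h

lemma Runs.op {P : List Instr} {o : ScalarOp} {c a b : ℕ}
    (h : Runs A P
      { s with scal := Function.update s.scal c (o.eval (s.scal a) (s.scal b)) } Q) :
    Runs A (.op o c a b :: P) s Q :=
  Runs.cons_eq (fun _ => Iff.rfl) h

lemma Runs.emit {P : List Instr} {a b : ℕ}
    (h : Runs A P { s with out := s.out ++ [(s.scal a, s.scal b)] } Q) :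
    Runs A (.emit a b :: P) s Q :=
  Runs.cons_eq (fun _ => Iff.rfl) h

lemma Runs.svd {P : List Instr} {m : ℕ}
    (h : ∀ b, IsRightSingularBasis (s.block m) b → Runs A P (s.afterSVD m b) Q) :
    Runs A (.svd m :: P) s Q := by
  obtain ⟨b, hb⟩ := exists_isRightSingularBasis (s.block m)
  refine Runs.cons ⟨_, b, hb, rfl⟩ ?_
  rintro u ⟨b', hb', rfl⟩
  exact h b' hb'

/-- Loop rule. -/
lemma Runs.flatMap_range {body : ℕ → List Instr} {I : ℕ → MState d → Prop} (m : ℕ) (h0 : I 0 s)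
    (h : ∀ j < m, ∀ t, I j t → Runs A (body j) t (I (j + 1))) :
    Runs A ((List.range m).flatMap body) s (I m) := by
  induction m with
  | zero => exact Runs.nil h0
  | succ m ih =>
    rw [List.range_succ, List.flatMap_append]
    refine Runs.append ((ih fun j hj => h j (by omega)).mono fun t ht => ?_)
    simpa using h m (by omega) t ht

end Runs

/-! ### Correctness of the programs -/

section Programs

variable {n d : ℕ} {A : Matrix (Fin n) (Fin d) ℝ}

lemma runs_shrink {ℓ m : ℕ} (hℓ : 1 ≤ ℓ) (hm : ℓ ≤ m) (hm' : m ≤ 2 * ℓ) (s : MState d) :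
    Runs A (shrink ℓ m) s fun t => t.pos = s.pos ∧ t.out = s.out ∧
      ∃ b, IsRightSingularBasis (s.block m) b ∧ ∀ r < m, t.rows r =
        shrunkRow (sv (s.block m)) (sv (s.block m) (ℓ - 1) * sv (s.block m) (ℓ - 1)) b r := by
  unfold shrink
  refine Runs.append (Runs.svd fun b hb => Runs.op (Runs.op (Runs.nil ?_)))
  set σ := sv (s.block m) with hσ
  set δ := σ (ℓ - 1) * σ (ℓ - 1) with hδ
  -- Loop invariant: rows below j are shrunk, the others still are raw singular vectors. The
  -- temporaries start at 2ℓ ≥ m and so never touch the singular values.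
  refine (Runs.flatMap_range (I := fun j t => t.pos = s.pos ∧ t.out = s.out ∧
    (∀ r < m, t.scal r = σ r) ∧ t.scal (2 * ℓ) = 0 ∧ t.scal (2 * ℓ + 1) = δ ∧
    (∀ r < j, t.rows r = shrunkRow σ δ b r) ∧
    ∀ r < m, j ≤ r → t.rows r = if h : r < d then b ⟨r, h⟩ else 0) m ?_ ?_).mono ?_
  · refine ⟨rfl, rfl, fun r hr => ?_, ?_, ?_, fun r hr => absurd hr (by omega), fun r hr _ => ?_⟩
    · simp [MState.afterSVD, hr, Function.update_apply, show r ≠ 2 * ℓ by omega,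
        show r ≠ 2 * ℓ + 1 by omega, hσ]
    · simp [Function.update_apply, ScalarOp.eval]
    · simp [ScalarOp.eval, MState.afterSVD, hδ, hσ,
        show ℓ - 1 ≠ 2 * ℓ by omega, show ℓ - 1 < m by omega]
    · simp [MState.afterSVD, hr]
  · rintro j hj t ⟨h1, h2, h3, h4, h5, h6, h7⟩
    refine Runs.op (Runs.op (Runs.op (Runs.op (Runs.scale (Runs.nil ?_)))))
    refine ⟨h1, h2, fun r hr => ?_, ?_, ?_, fun r hr => ?_, fun r hr hr' => ?_⟩
    · simp [show r ≠ 2 * ℓ + 2 by omega, h3 r hr]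
    · simp [h4]
    · simp [h5]
    · rcases Nat.lt_succ_iff_lt_or_eq.1 hr with hr | rfl
      · simp [hr.ne, h6 r hr]
      · simp [ScalarOp.eval, h3 r hj, h4, h5, h7 r hj le_rfl, shrunkRow]
    · simp [show r ≠ j by omega, h7 r hr (by omega)]
  · rintro t ⟨h1, h2, -, -, -, h6, -⟩
    exact ⟨h1, h2, b, hb, h6⟩

lemma isSketch_shrunkRow {ℓ p m q : ℕ} {u : ℕ → EuclideanSpace ℝ (Fin d)} {s : MState d}
    {b : OrthonormalBasis (Fin d) ℝ (EuclideanSpace ℝ (Fin d))}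
    (hs : IsSketch ℓ u p s.rows m) (hb : IsRightSingularBasis (s.block m) b) (hq : ℓ - 1 ≤ q) :
    IsSketch ℓ u p (shrunkRow (sv (s.block m))
      (sv (s.block m) (ℓ - 1) * sv (s.block m) (ℓ - 1)) b) q :=
  hs.shrink (sv_antitone _) (sv_nonneg _) (fun _ => sv_eq_zero_of_width_le _)
    (fun j => by rw [rowGram_block]; exact hb j) hq

/-- Induction on the number of unread rows. The continuation has to be verified only for buffers
that sketch the whole input with at most ℓ rows. -/
lemma runs_freqDir {ℓ : ℕ} (hℓ : 1 ≤ ℓ) {K : ℕ → List Instr} {Q : MState d → Prop}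
    (hK : ∀ m ≤ ℓ, ∀ t : MState d, t.out = [] → IsSketch ℓ (streamRow A) n t.rows m →
      Runs A (K m) t Q) :
    ∀ (k fill : ℕ) (s : MState d), fill < 2 * ℓ → s.pos + k = n → s.out = [] →
      IsSketch ℓ (streamRow A) s.pos s.rows fill → Runs A (freqDir ℓ K k fill) s Q := by
  intro k
  induction k with
  | zero =>
    intro fill s hfill hpos hout hs
    have hpos' : s.pos = n := by omega
    rw [freqDir]
    split_ifs with h
    · refine Runs.append ((runs_shrink hℓ h hfill.le s).mono ?_)
      rintro t ⟨-, h2, b, hb, h3⟩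
      rw [min_eq_right h]
      refine hK ℓ le_rfl t (h2.trans hout) ?_
      refine IsSketch.congr ?_ fun r hr => (h3 r (by omega)).symm
      exact isSketch_shrunkRow (hpos' ▸ hs) hb (Nat.sub_le _ _)
    · rw [List.nil_append, min_eq_left (by omega)]
      exact hK fill (by omega) s hout (hpos' ▸ hs)
  | succ k ih =>
    intro fill s hfill hpos hout hs
    rw [freqDir]
    refine Runs.read (by omega) ?_
    set s' : MState d := { s with
      rows := Function.update s.rows fill (streamRow A s.pos), pos := s.pos + 1 } with hs'
    have hsk : IsSketch ℓ (streamRow A) s'.pos s'.rows (fill + 1) := hs.insert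
    split_ifs with h
    · rw [h] at hsk
      refine Runs.append ((runs_shrink hℓ (by omega) le_rfl s').mono ?_)
      rintro t ⟨h1, h2, b, hb, h3⟩
      refine ih (ℓ - 1) t (by omega) ?_ (h2.trans hout) ?_
      · rw [h1]
        simp only [hs']
        omega
      · rw [h1]
        exact (isSketch_shrunkRow hsk hb le_rfl).congr fun r hr => (h3 r (by omega)).symm
    · exact ih (fill + 1) s' (by omega) (by simp only [hs']; omega) hout hsk

/-- The scores of `a` with respect to estimates `σ r`, `w r` of singular values and vectors. -/
noncomputable def scorePair (k : ℕ) (σ : ℕ → ℝ) (w : ℕ → EuclideanSpace ℝ (Fin d))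
    (a : EuclideanSpace ℝ (Fin d)) : ℝ × ℝ :=
  (∑ j ∈ Finset.range k, inner ℝ a (w j) ^ 2 / σ j ^ 2,
    ‖a‖ ^ 2 - ∑ j ∈ Finset.range k, inner ℝ a (w j) ^ 2)

lemma runs_scoreRow {ℓ k : ℕ} (hk : k ≤ ℓ) (s : MState d) (hs : s.pos < n) :
    Runs A (scoreRow ℓ k) s fun t => t.pos = s.pos + 1 ∧
      (∀ r < k, t.rows r = s.rows r) ∧ (∀ r < k, t.scal r = s.scal r) ∧
      t.out = s.out ++ [scorePair k s.scal s.rows (streamRow A s.pos)] := by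
  unfold scoreRow
  refine Runs.append (Runs.append (Runs.read hs (Runs.op (Runs.dot (Runs.nil ?_)))))
  -- Registers 2ℓ and 2ℓ + 1 hold the two scores restricted to the first j directions.
  refine (Runs.flatMap_range (I := fun j t => t.pos = s.pos + 1 ∧ t.out = s.out ∧
    (∀ r < k, t.rows r = s.rows r) ∧ (∀ r < k, t.scal r = s.scal r) ∧
    t.rows (2 * ℓ) = streamRow A s.pos ∧
    t.scal (2 * ℓ) = (scorePair j s.scal s.rows (streamRow A s.pos)).1 ∧
    t.scal (2 * ℓ + 1) = (scorePair j s.scal s.rows (streamRow A s.pos)).2) k ?_ ?_).mono ?_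
  · refine ⟨rfl, rfl, fun r hr => ?_, fun r hr => ?_, ?_, ?_, ?_⟩
    · simp [show r ≠ 2 * ℓ by omega]
    · simp [show r ≠ 2 * ℓ by omega, show r ≠ 2 * ℓ + 1 by omega]
    · simp
    · simp [ScalarOp.eval, scorePair]
    · simp [scorePair]
  · rintro j hj t ⟨h1, h2, h3, h4, h5, h6, h7⟩
    refine Runs.dot (Runs.op (Runs.op (Runs.op (Runs.op (Runs.op (Runs.nil ?_))))))
    refine ⟨h1, h2, h3, fun r hr => ?_, h5, ?_, ?_⟩
    · simp [Function.update_apply, show r ≠ 2 * ℓ by omega, show r ≠ 2 * ℓ + 1 by omega,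
        show r ≠ 2 * ℓ + 2 by omega, show r ≠ 2 * ℓ + 3 by omega, h4 r hr]
    · simp [ScalarOp.eval, h3 j hj, h4 j hj, h5, h6,
        show j ≠ 2 * ℓ + 1 by omega,
        show j ≠ 2 * ℓ + 2 by omega, scorePair, Finset.sum_range_succ, ← sq]
    · simp [Function.update_apply, ScalarOp.eval, h3 j hj, h5, h7,
        scorePair, Finset.sum_range_succ, ← sq, sub_sub]
  · rintro t ⟨h1, h2, h3, h4, h5, h6, h7⟩
    refine Runs.emit (Runs.nil ⟨h1, h3, h4, ?_⟩)
    simp only [h2, h6, h7]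

lemma scorePair_congr {k : ℕ} {σ σ' : ℕ → ℝ} {w w' : ℕ → EuclideanSpace ℝ (Fin d)}
    (hσ : ∀ r < k, σ r = σ' r) (hw : ∀ r < k, w r = w' r) (a : EuclideanSpace ℝ (Fin d)) :
    scorePair k σ w a = scorePair k σ' w' a := by
  have h : ∀ j ∈ Finset.range k, inner ℝ a (w j) ^ 2 = inner ℝ a (w' j) ^ 2 := fun j hj => by
    rw [hw j (Finset.mem_range.1 hj)]
  have h' : ∀ j ∈ Finset.range k,
      inner ℝ a (w j) ^ 2 / σ j ^ 2 = inner ℝ a (w' j) ^ 2 / σ' j ^ 2 := fun j hj => by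
    rw [h j hj, hσ j (Finset.mem_range.1 hj)]
  rw [scorePair, scorePair, Finset.sum_congr rfl h, Finset.sum_congr rfl h']

lemma runs_scoreRows {ℓ k : ℕ} (hk : k ≤ ℓ) (s : MState d) (hs : s.pos = 0) (hout : s.out = []) :
    Runs A (List.replicate n (scoreRow ℓ k)).flatten s fun t =>
      t.out = List.ofFn fun i : Fin n => scorePair k s.scal s.rows (rowVec A i) := by
  have hflat : (List.replicate n (scoreRow ℓ k)).flatten
      = (List.range n).flatMap fun _ => scoreRow ℓ k := by
    rw [List.flatMap_def, List.map_const', List.length_range]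
  rw [hflat]
  refine (Runs.flatMap_range (I := fun j t => t.pos = j ∧
    (∀ r < k, t.rows r = s.rows r) ∧ (∀ r < k, t.scal r = s.scal r) ∧
    t.out = (List.range j).map fun i => scorePair k s.scal s.rows (streamRow A i)) n ?_ ?_).mono ?_
  · exact ⟨hs, fun _ _ => rfl, fun _ _ => rfl, by simp [hout]⟩
  · rintro j hj t ⟨h1, h2, h3, h4⟩
    refine (runs_scoreRow hk t (by omega)).mono ?_
    rintro u ⟨g1, g2, g3, g4⟩
    refine ⟨by omega, fun r hr => (g2 r hr).trans (h2 r hr),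
      fun r hr => (g3 r hr).trans (h3 r hr), ?_⟩
    rw [g4, h4, List.range_succ, List.map_append, scorePair_congr h3 h2, h1]
    simp
  · rintro t ⟨-, -, -, h4⟩
    rw [h4]
    refine List.ext_getElem (by simp) fun i hi hi' => ?_
    have : i < n := by simpa using hi
    simp [streamRow, this]

/-- Whatever the algorithm outputs, it consists of the scores with respect to the singular values
and vectors of a sketch of the rows with `m ≤ ℓ` rows. -/
lemma runs_twoPassFD {k ℓ : ℕ} (hℓ : 1 ≤ ℓ) (hk : k ≤ ℓ) :
    Runs A (twoPassFD n k ℓ) (MState.init d) fun t =>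
      ∃ m ≤ ℓ, ∃ (B : Matrix (Fin m) (Fin d) ℝ) (w : ℕ → EuclideanSpace ℝ (Fin d))
        (b : OrthonormalBasis (Fin d) ℝ (EuclideanSpace ℝ (Fin d))),
        IsSketch ℓ (streamRow A) n w m ∧
        rowGram w m = (B.transpose * B).toEuclideanLin ∧ IsRightSingularBasis B b ∧
        (k ≤ m → t.out = List.ofFn fun i : Fin n => scorePair k (sv B)
          (fun r => if h : r < d then b ⟨r, h⟩ else 0) (rowVec A i)) := by
  unfold twoPassFD
  refine runs_freqDir hℓ ?_ n 0 _ (by omega) (by simp [MState.init]) rfl (isSketch_zero _ _ _)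
  intro m hm s hout hs
  refine Runs.svd fun b hb => Runs.rewind ?_
  refine Runs.mono (runs_scoreRows hk _ rfl (by exact hout)) fun t ht => ?_
  refine ⟨m, hm, s.block m, s.rows, b, hs, rowGram_block s m, hb, fun hkm => ht.trans ?_⟩
  congr 1
  ext1 i
  -- The final decomposition writes only registers below m, hence the proviso k ≤ m.
  refine scorePair_congr (fun r hr => ?_) (fun r hr => ?_) _ <;>
    simp [MState.afterSVD, hr.trans_le hkm]

end Programs

/-! ### Perturbation of spectral quadratic forms -/

section Perturbation

variable {d : ℕ} {M N : EuclideanSpace ℝ (Fin d) →ₗ[ℝ] EuclideanSpace ℝ (Fin d)}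
  {v w : OrthonormalBasis (Fin d) ℝ (EuclideanSpace ℝ (Fin d))} {lam mu : Fin d → ℝ} {η : ℝ}

lemma inner_map_self_eq_sum (hv : ∀ i, M (v i) = lam i • v i) (x : EuclideanSpace ℝ (Fin d)) :
    inner ℝ x (M x) = ∑ i, lam i * inner ℝ (v i) x ^ 2 := by
  conv_lhs => rw [← v.sum_repr' x, map_sum, v.sum_repr' x, inner_sum]
  refine Finset.sum_congr rfl fun i _ => ?_
  rw [map_smul, hv, real_inner_smul_right, real_inner_smul_right, real_inner_comm (v i) x]
  ring

/-- Weyl's inequality for eigenvalues in decreasing order, in one direction. -/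
lemma eigenvalue_le_add (hv : ∀ i, M (v i) = lam i • v i) (hw : ∀ i, N (w i) = mu i • w i)
    (hlam : Antitone lam) (hmu : Antitone mu) (h : ∀ x, ‖M x - N x‖ ≤ η * ‖x‖) (j : Fin d) :
    lam j ≤ mu j + η := by
  -- Courant–Fischer by dimension count: coordinate j of T is zero, so T is not onto, hence not
  -- injective. A nonzero kernel vector lies in the span of the v r with r ≤ j and in that of the w
  -- r with r ≥ j.
  let T : EuclideanSpace ℝ (Fin d) →ₗ[ℝ] (Fin d → ℝ) := LinearMap.pi fun r =>
    if r < j then innerₛₗ ℝ (w r) else if j < r then innerₛₗ ℝ (v r) else 0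
  have hT : ¬ Function.Injective T := by
    rw [LinearMap.injective_iff_surjective_of_finrank_eq_finrank (by simp)]
    intro hsurj
    obtain ⟨x, hx⟩ := hsurj (Pi.single j 1)
    simpa [T] using congrFun hx j
  rw [injective_iff_map_eq_zero] at hT
  push Not at hT
  obtain ⟨x, hx, hx0⟩ := hT
  have hxw : ∀ r < j, inner ℝ (w r) x = 0 := fun r hr => by
    simpa [T, hr] using congrFun hx r
  have hxv : ∀ r, j < r → inner ℝ (v r) x = 0 := fun r hr => by
    simpa [T, hr, hr.not_gt] using congrFun hx r
  have h1 : lam j * ‖x‖ ^ 2 ≤ inner ℝ x (M x) := by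
    rw [inner_map_self_eq_sum hv, ← v.sum_sq_inner_right x, Finset.mul_sum]
    refine Finset.sum_le_sum fun r _ => ?_
    rcases lt_or_ge j r with hr | hr
    · simp [hxv r hr]
    · exact mul_le_mul_of_nonneg_right (hlam hr) (sq_nonneg _)
  have h2 : inner ℝ x (N x) ≤ mu j * ‖x‖ ^ 2 := by
    rw [inner_map_self_eq_sum hw, ← w.sum_sq_inner_right x, Finset.mul_sum]
    refine Finset.sum_le_sum fun r _ => ?_
    rcases lt_or_ge r j with hr | hr
    · simp [hxw r hr]
    · exact mul_le_mul_of_nonneg_right (hmu hr) (sq_nonneg _)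
  have h3 : inner ℝ x (M x) - inner ℝ x (N x) ≤ η * ‖x‖ ^ 2 := by
    rw [← inner_sub_right]
    calc _ ≤ ‖x‖ * ‖M x - N x‖ := real_inner_le_norm _ _
      _ ≤ ‖x‖ * (η * ‖x‖) := mul_le_mul_of_nonneg_left (h x) (norm_nonneg _)
      _ = _ := by ring
  have hpos : 0 < ‖x‖ ^ 2 := by positivity
  refine le_of_mul_le_mul_right ?_ hpos
  linarith

lemma sum_ite_lt_le (k : ℕ) {F : Fin d → ℝ} {c : ℝ} (hc : 0 ≤ c) (hF : ∀ i, F i ≤ c) :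
    ∑ i : Fin d, (if i.val < k then F i else 0) ≤ k * c := by
  rw [← Finset.sum_filter]
  refine (Finset.sum_le_card_nsmul _ _ c fun i _ => hF i).trans ?_
  rw [nsmul_eq_mul]
  refine mul_le_mul_of_nonneg_right ?_ hc
  rw [Fin.card_filter_val_lt]
  exact_mod_cast min_le_right _ _

/-- Two quadratic forms `∑ fᵢ (aᵀ vᵢ)²` and `∑ gⱼ (aᵀ wⱼ)²`, both functions of rank `k` of close
symmetric operators, are close if the divided differences of `f` and `g` are bounded. -/
lemma abs_sum_sub_sum_le (hM : ∀ x y, inner ℝ (M x) y = inner ℝ x (M y))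
    (hN : ∀ x y, inner ℝ (N x) y = inner ℝ x (N y))
    (hv : ∀ i, M (v i) = lam i • v i) (hw : ∀ i, N (w i) = mu i • w i)
    (hη : 0 ≤ η) (h : ∀ x, ‖M x - N x‖ ≤ η * ‖x‖) {k : ℕ} (hk : 1 ≤ k) {f g : Fin d → ℝ} {K : ℝ}
    (hK0 : 0 ≤ K) (hf : ∀ i, k ≤ i.val → f i = 0) (hg : ∀ i, k ≤ i.val → g i = 0)
    (hK : ∀ i j : Fin d, i.val < k ∨ j.val < k → |f i - g j| ≤ K * |lam i - mu j|)
    (a : EuclideanSpace ℝ (Fin d)) :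
    |∑ i, f i * inner ℝ a (v i) ^ 2 - ∑ j, g j * inner ℝ a (w j) ^ 2|
      ≤ 2 * k * K * η * ‖a‖ ^ 2 := by
  set e : Fin d → Fin d → ℝ := fun i j => inner ℝ (v i) (M (w j) - N (w j)) with he
  have he1 : ∀ i j, e i j = (lam i - mu j) * inner ℝ (v i) (w j) := fun i j => by
    simp only [he]
    rw [inner_sub_right, ← hM, hv, hw, real_inner_smul_left, real_inner_smul_right, sub_mul]
  have he2 : ∀ i j, e i j = inner ℝ (M (v i) - N (v i)) (w j) := fun i j => by
    simp only [he]
    rw [inner_sub_right, inner_sub_left, hM, hN]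
  have hunit : ∀ x : EuclideanSpace ℝ (Fin d), ‖x‖ = 1 → ‖M x - N x‖ ^ 2 ≤ η ^ 2 := fun x hx => by
    have := h x
    rw [hx, mul_one] at this
    exact pow_le_pow_left₀ (norm_nonneg _) this 2
  have hrow : ∀ i, ∑ j, e i j ^ 2 ≤ η ^ 2 := fun i => by
    simp_rw [he2]
    rw [w.sum_sq_inner_left]
    exact hunit _ (v.norm_eq_one i)
  have hcol : ∀ j, ∑ i, e i j ^ 2 ≤ η ^ 2 := fun j => by
    rw [v.sum_sq_inner_right]
    exact hunit _ (w.norm_eq_one j)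
  have hexp1 : ∀ i, inner ℝ a (v i) = ∑ j, inner ℝ a (w j) * inner ℝ (v i) (w j) := fun i => by
    rw [← w.sum_inner_mul_inner a (v i)]
    exact Finset.sum_congr rfl fun j _ => by rw [real_inner_comm (w j) (v i)]
  have hexp2 : ∀ j, inner ℝ a (w j) = ∑ i, inner ℝ a (v i) * inner ℝ (v i) (w j) := fun j =>
    (v.sum_inner_mul_inner a (w j)).symm
  -- One factor of each square is expanded in the other basis, so that both forms become sums over
  -- the same pairs.
  have hD : ∑ i, f i * inner ℝ a (v i) ^ 2 - ∑ j, g j * inner ℝ a (w j) ^ 2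
      = ∑ q : Fin d × Fin d, ((f q.1 - g q.2) * inner ℝ (v q.1) (w q.2))
          * (inner ℝ a (v q.1) * inner ℝ a (w q.2)) := by
    have h1 : ∑ i, f i * inner ℝ a (v i) ^ 2 = ∑ i, ∑ j,
        f i * inner ℝ (v i) (w j) * (inner ℝ a (v i) * inner ℝ a (w j)) := by
      refine Finset.sum_congr rfl fun i _ => ?_
      rw [sq]
      nth_rewrite 2 [hexp1 i]
      rw [Finset.mul_sum, Finset.mul_sum]
      exact Finset.sum_congr rfl fun j _ => by ring
    have h2 : ∑ j, g j * inner ℝ a (w j) ^ 2 = ∑ i, ∑ j,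
        g j * inner ℝ (v i) (w j) * (inner ℝ a (v i) * inner ℝ a (w j)) := by
      rw [Finset.sum_comm]
      refine Finset.sum_congr rfl fun j _ => ?_
      rw [sq]
      nth_rewrite 2 [hexp2 j]
      rw [Finset.mul_sum, Finset.mul_sum]
      exact Finset.sum_congr rfl fun i _ => by ring
    rw [h1, h2, ← Finset.sum_sub_distrib, Fintype.sum_prod_type]
    refine Finset.sum_congr rfl fun i _ => ?_
    rw [← Finset.sum_sub_distrib]
    exact Finset.sum_congr rfl fun j _ => by ring
  -- Frobenius bound: a pair contributes only if it lies in one of the first k rows or first k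
  -- columns of e.
  have hS1 : ∑ q : Fin d × Fin d, ((f q.1 - g q.2) * inner ℝ (v q.1) (w q.2)) ^ 2
      ≤ K ^ 2 * (2 * k * η ^ 2) := by
    calc _ ≤ ∑ q : Fin d × Fin d, K ^ 2 *
          ((if q.1.val < k then e q.1 q.2 ^ 2 else 0)
            + if q.2.val < k then e q.1 q.2 ^ 2 else 0) := by
          refine Finset.sum_le_sum fun q _ => ?_
          by_cases hq : q.1.val < k ∨ q.2.val < k
          · have h1 : ((f q.1 - g q.2) * inner ℝ (v q.1) (w q.2)) ^ 2 ≤ K ^ 2 * e q.1 q.2 ^ 2 := by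
              rw [he1, mul_pow, mul_pow, ← mul_assoc]
              refine mul_le_mul_of_nonneg_right ?_ (sq_nonneg _)
              rw [← mul_pow, sq_le_sq, abs_mul, abs_of_nonneg hK0]
              exact hK _ _ hq
            refine h1.trans (mul_le_mul_of_nonneg_left ?_ (sq_nonneg _))
            have := sq_nonneg (e q.1 q.2)
            split_ifs <;> first | linarith | exact absurd hq (by tauto)
          · push Not at hq
            rw [hf _ hq.1, hg _ hq.2, sub_zero, zero_mul, if_neg hq.1.not_gt, if_neg hq.2.not_gt]
            simp
      _ = K ^ 2 * (∑ i : Fin d, (if i.val < k then ∑ j, e i j ^ 2 else 0)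
            + ∑ j : Fin d, (if j.val < k then ∑ i, e i j ^ 2 else 0)) := by
          rw [← Finset.mul_sum, Finset.sum_add_distrib, Fintype.sum_prod_type,
            Fintype.sum_prod_type_right]
          congr 2 <;> refine Finset.sum_congr rfl fun i _ => ?_ <;> split_ifs <;> simp
      _ ≤ _ := by
          refine mul_le_mul_of_nonneg_left ?_ (sq_nonneg _)
          have h1 := sum_ite_lt_le k (sq_nonneg η) hrow
          have h2 := sum_ite_lt_le k (sq_nonneg η) hcol
          linarith
  have hS2 : ∑ q : Fin d × Fin d, (inner ℝ a (v q.1) * inner ℝ a (w q.2)) ^ 2 = ‖a‖ ^ 4 := by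
    rw [Fintype.sum_prod_type]
    simp_rw [mul_pow, ← Finset.mul_sum, w.sum_sq_inner_left, ← Finset.sum_mul,
      v.sum_sq_inner_left]
    ring
  refine abs_le_of_sq_le_sq ?_ (by positivity)
  rw [hD]
  refine (Finset.sum_mul_sq_le_sq_mul_sq _ _ _).trans ?_
  rw [hS2]
  refine (mul_le_mul_of_nonneg_right hS1 (by positivity)).trans ?_
  have hk' : (1 : ℝ) ≤ k := by exact_mod_cast hk
  -- Cauchy–Schwarz gives the factor √(2k), relaxed here to 2k.
  have : (2 * k : ℝ) ≤ (2 * k) ^ 2 := by nlinarith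
  calc K ^ 2 * (2 * k * η ^ 2) * ‖a‖ ^ 4 = (2 * k) * (K ^ 2 * η ^ 2 * ‖a‖ ^ 4) := by ring
    _ ≤ (2 * k) ^ 2 * (K ^ 2 * η ^ 2 * ‖a‖ ^ 4) :=
      mul_le_mul_of_nonneg_right this (by positivity)
    _ = _ := by ring

end Perturbation

/-! ### Memory and running time -/

section Resources

/-- The instruction gets by with `2 ℓ + 1` row registers, `2 ℓ + 4` scalar registers and work space
for `2 ℓ` rows. -/
def Instr.Fits (d ℓ : ℕ) (c : Instr) : Prop :=
  c.rowRegs ≤ 2 * ℓ + 1 ∧ c.scalRegs ≤ 2 * ℓ + 4 ∧ c.work d ≤ 2 * ℓ * d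

variable {d ℓ : ℕ}

lemma foldr_max_le {L : List ℕ} {B : ℕ} (h : ∀ x ∈ L, x ≤ B) : L.foldr max 0 ≤ B := by
  induction L with
  | nil => exact Nat.zero_le _
  | cons a L ih =>
    simp only [List.mem_cons, forall_eq_or_imp] at h
    exact max_le h.1 (ih h.2)

lemma memory_le {P : List Instr} (h : ∀ c ∈ P, c.Fits d ℓ) :
    memory d P ≤ d * (2 * ℓ + 1) + (2 * ℓ + 4) + 2 * ℓ * d := by
  refine add_le_add (add_le_add (Nat.mul_le_mul_left _ ?_) ?_) ?_ <;>
    refine foldr_max_le fun x hx => ?_ <;> obtain ⟨c, hc, rfl⟩ := List.mem_map.1 hx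
  · exact (h c hc).1
  · exact (h c hc).2.1
  · exact (h c hc).2.2

lemma fits_svd {m : ℕ} (hm : m ≤ 2 * ℓ) : (Instr.svd m).Fits d ℓ :=
  ⟨by simp only [Instr.rowRegs]; omega, by simp only [Instr.scalRegs]; omega,
    Nat.mul_le_mul_right d hm⟩

lemma fits_shrink {m : ℕ} (hm : m ≤ 2 * ℓ) : ∀ c ∈ shrink ℓ m, c.Fits d ℓ := by
  intro c hc
  simp only [shrink, List.mem_append, List.mem_cons, List.mem_flatMap, List.mem_range,
    List.not_mem_nil, or_false] at hc
  rcases hc with (rfl | rfl | rfl) | ⟨j, hj, rfl | rfl | rfl | rfl | rfl⟩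
  · exact fits_svd hm
  all_goals
    refine ⟨?_, ?_, Nat.zero_le _⟩ <;> simp only [Instr.rowRegs, Instr.scalRegs] <;> omega

lemma fits_scoreRow {k : ℕ} (hk : k ≤ ℓ) : ∀ c ∈ scoreRow ℓ k, c.Fits d ℓ := by
  intro c hc
  simp only [scoreRow, List.mem_append, List.mem_cons, List.mem_flatMap, List.mem_range,
    List.not_mem_nil, or_false] at hc
  rcases hc with ((rfl | rfl | rfl) | ⟨j, hj, rfl | rfl | rfl | rfl | rfl | rfl⟩) | rfl
  all_goals
    refine ⟨?_, ?_, Nat.zero_le _⟩ <;> simp only [Instr.rowRegs, Instr.scalRegs] <;> omega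

lemma fits_freqDir {K : ℕ → List Instr} (hK : ∀ m ≤ ℓ, ∀ c ∈ K m, c.Fits d ℓ) :
    ∀ (n fill : ℕ), fill < 2 * ℓ → ∀ c ∈ freqDir ℓ K n fill, c.Fits d ℓ := by
  intro n
  induction n with
  | zero =>
    intro fill hfill c hc
    rw [freqDir, List.mem_append] at hc
    rcases hc with hc | hc
    · split_ifs at hc
      · exact fits_shrink hfill.le c hc
      · exact absurd hc List.not_mem_nil
    · exact hK _ (min_le_right _ _) c hc
  | succ n ih =>
    intro fill hfill c hc
    rw [freqDir, List.mem_cons] at hc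
    rcases hc with rfl | hc
    · refine ⟨?_, Nat.zero_le _, Nat.zero_le _⟩
      simp only [Instr.rowRegs]
      omega
    · split_ifs at hc
      · rcases List.mem_append.1 hc with hc | hc
        · exact fits_shrink le_rfl c hc
        · exact ih _ (by omega) c hc
      · exact ih _ (by omega) c hc

lemma memory_twoPassFD_le (n k : ℕ) (hd : 1 ≤ d) (hℓ : 1 ≤ ℓ) (hk : k ≤ ℓ) :
    memory d (twoPassFD n k ℓ) ≤ 11 * (d * ℓ) := by
  have h : ∀ c ∈ twoPassFD n k ℓ, c.Fits d ℓ := by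
    refine fits_freqDir (fun m hm c hc => ?_) n 0 (by omega)
    simp only [List.mem_cons, List.mem_flatten, List.mem_replicate] at hc
    rcases hc with rfl | rfl | ⟨l, ⟨-, rfl⟩, hc⟩
    · exact fits_svd (by omega)
    · exact ⟨Nat.zero_le _, Nat.zero_le _, Nat.zero_le _⟩
    · exact fits_scoreRow hk c hc
  refine (memory_le h).trans ?_
  nlinarith [Nat.mul_le_mul hd hℓ, Nat.mul_le_mul_left d hℓ, Nat.mul_le_mul_right ℓ hd]

lemma runTime_append (P R : List Instr) : runTime d (P ++ R) = runTime d P + runTime d R := by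
  simp [runTime]

lemma runTime_cons (c : Instr) (P : List Instr) :
    runTime d (c :: P) = c.cost d + runTime d P := by
  simp [runTime]

lemma runTime_nil : runTime d [] = 0 := rfl

lemma runTime_flatMap_range {body : ℕ → List Instr} {c : ℕ} (h : ∀ j, runTime d (body j) = c)
    (m : ℕ) : runTime d ((List.range m).flatMap body) = m * c := by
  induction m with
  | zero => simp [runTime]
  | succ m ih =>
    rw [List.range_succ, List.flatMap_append, runTime_append, ih]
    simp [h, Nat.succ_mul]

lemma runTime_shrink_le {m : ℕ} (hd : 1 ≤ d) (hℓ : 1 ≤ ℓ) (hm : m ≤ 2 * ℓ) :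
    runTime d (shrink ℓ m) ≤ 17 * ℓ * d * ℓ := by
  rw [shrink, runTime_append, runTime_flatMap_range (c := 4 + d)
    (fun j => by simp only [runTime_cons, runTime_nil, Instr.cost]; ring)]
  simp only [runTime_cons, runTime_nil, Instr.cost]
  have h1 : m * d * min m d ≤ 2 * ℓ * d * (2 * ℓ) :=
    Nat.mul_le_mul (Nat.mul_le_mul_right d hm) ((min_le_left _ _).trans hm)
  have h2 : m * (4 + d) ≤ 2 * ℓ * (5 * d) := Nat.mul_le_mul hm (by omega)
  have h3 : ℓ * d ≤ ℓ * d * ℓ := Nat.le_mul_of_pos_right _ hℓ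
  have h4 : 1 ≤ ℓ * d := Nat.mul_pos hℓ hd
  nlinarith

lemma runTime_scoreRow_le {k : ℕ} (hd : 1 ≤ d) (hℓ : 1 ≤ ℓ) (hk : k ≤ ℓ) :
    runTime d (scoreRow ℓ k) ≤ 13 * ℓ * d := by
  rw [scoreRow, runTime_append, runTime_append, runTime_flatMap_range (c := 2 * d + 5)
    (fun j => by simp only [runTime_cons, runTime_nil, Instr.cost])]
  simp only [runTime_cons, runTime_nil, Instr.cost]
  have h2 : k * (2 * d + 5) ≤ ℓ * (7 * d) := Nat.mul_le_mul hk (by omega)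
  have h3 : d ≤ ℓ * d := Nat.le_mul_of_pos_left _ hℓ
  nlinarith

/-- The shrinking steps are paid for by the rows read since the previous one. -/
lemma runTime_freqDir_le {K : ℕ → List Instr} {R : ℕ} (hd : 1 ≤ d) (hℓ : 1 ≤ ℓ)
    (hK : ∀ m ≤ ℓ, runTime d (K m) ≤ ℓ * d * m + R) :
    ∀ (n fill : ℕ), fill < 2 * ℓ →
      runTime d (freqDir ℓ K n fill) ≤ d * n + 18 * (ℓ * d) * (n + fill) + R := by
  intro n
  induction n with
  | zero =>
    intro fill hfill
    rw [freqDir, runTime_append]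
    have h1 := hK (min fill ℓ) (min_le_right _ _)
    have h2 : ℓ * d * min fill ℓ ≤ ℓ * d * fill := Nat.mul_le_mul_left _ (min_le_left _ _)
    split_ifs with h
    · have h3 := runTime_shrink_le hd hℓ hfill.le
      have h4 : ℓ * d * ℓ ≤ ℓ * d * fill := Nat.mul_le_mul_left _ h
      nlinarith
    · rw [runTime_nil]
      nlinarith [Nat.zero_le (ℓ * d * fill)]
  | succ n ih =>
    intro fill hfill
    rw [freqDir, runTime_cons, Instr.cost]
    split_ifs with h
    · have h1 := runTime_shrink_le hd hℓ le_rfl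
      have h2 := ih (ℓ - 1) (by omega)
      rw [runTime_append]
      -- Potential of 18ℓd per buffered row: a shrink frees ℓ + 1 rows and costs at most 17ℓd·ℓ. The
      -- extra unit over 17 pays for decomposing the final sketch when the stream ends.
      have h3 : 18 * (ℓ * d) * (n + (ℓ - 1)) + 17 * (ℓ * d) * ℓ
          ≤ 18 * (ℓ * d) * (n + 1 + fill) := by
        calc _ ≤ 18 * (ℓ * d) * (n + (ℓ - 1)) + 18 * (ℓ * d) * ℓ := by gcongr; norm_num
          _ = 18 * (ℓ * d) * (n + (ℓ - 1) + ℓ) := by ring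
          _ ≤ _ := Nat.mul_le_mul_left _ (by omega)
      linarith
    · have h2 := ih (fill + 1) (by omega)
      linarith

lemma runTime_twoPassFD_le {n k : ℕ} (hn : 1 ≤ n) (hd : 1 ≤ d) (hℓ : 1 ≤ ℓ) (hk : k ≤ ℓ) :
    runTime d (twoPassFD n k ℓ) ≤ 34 * (n * d * ℓ) := by
  have h := runTime_freqDir_le (R := 2 + n * (13 * ℓ * d)) hd hℓ
    (K := fun m => .svd m :: .rewind :: (List.replicate n (scoreRow ℓ k)).flatten)
    (fun m hm => ?_) n 0 (by omega)
  · refine h.trans ?_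
    have h1 : n * d ≤ n * d * ℓ := Nat.le_mul_of_pos_right _ hℓ
    have h2 : 1 ≤ n * d := Nat.mul_pos hn hd
    -- 34 = 1 + 18 + 2 + 13: reading, shrinking, the constant 2 and scoring.
    nlinarith
  · have hflat : (List.replicate n (scoreRow ℓ k)).flatten
        = (List.range n).flatMap fun _ => scoreRow ℓ k := by
      rw [List.flatMap_def, List.map_const', List.length_range]
    rw [runTime_cons, runTime_cons, hflat, runTime_flatMap_range fun _ => rfl]
    simp only [Instr.cost]
    have h1 : m * d * min m d ≤ m * d * ℓ := Nat.mul_le_mul_left _ ((min_le_left _ _).trans hm)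
    have h2 := Nat.mul_le_mul_left n (runTime_scoreRow_le hd hℓ hk)
    nlinarith

end Resources

/-! ### From Gram error to score error -/

lemma sum_range_eq_sum_ite {d k : ℕ} (hk : k ≤ d) (F : ℕ → ℝ) :
    ∑ r ∈ Finset.range k, F r = ∑ j : Fin d, if j.val < k then F j else 0 := by
  rw [Fin.sum_univ_eq_sum_range (fun r => if r < k then F r else 0) d, ← Finset.sum_filter]
  congr 1
  ext r
  simp only [Finset.mem_range, Finset.mem_filter]
  omega

section Scores

variable {n d m : ℕ}

lemma scorePair_fst {k : ℕ} (hk : k ≤ d) (B : Matrix (Fin m) (Fin d) ℝ)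
    (b : OrthonormalBasis (Fin d) ℝ (EuclideanSpace ℝ (Fin d))) (a : EuclideanSpace ℝ (Fin d)) :
    (scorePair k (sv B) (fun r => if h : r < d then b ⟨r, h⟩ else 0) a).1
      = ∑ j : Fin d, (if j.val < k then (sv B j ^ 2)⁻¹ else 0) * inner ℝ a (b j) ^ 2 := by
  simp only [scorePair]
  rw [sum_range_eq_sum_ite hk]
  refine Finset.sum_congr rfl fun j _ => ?_
  by_cases hj : j.val < k <;> simp [hj, div_eq_inv_mul]

lemma scorePair_snd {k : ℕ} (hk : k ≤ d) (σ : ℕ → ℝ)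
    (b : OrthonormalBasis (Fin d) ℝ (EuclideanSpace ℝ (Fin d))) (a : EuclideanSpace ℝ (Fin d)) :
    (scorePair k σ (fun r => if h : r < d then b ⟨r, h⟩ else 0) a).2
      = ‖a‖ ^ 2 - ∑ j : Fin d, (if j.val < k then 1 else 0) * inner ℝ a (b j) ^ 2 := by
  simp only [scorePair]
  rw [sum_range_eq_sum_ite hk]
  congr 1
  refine Finset.sum_congr rfl fun j _ => ?_
  by_cases hj : j.val < k <;> simp [hj]

lemma leverage_eq_sum (A : Matrix (Fin n) (Fin d) ℝ)
    (v : OrthonormalBasis (Fin d) ℝ (EuclideanSpace ℝ (Fin d))) (k : ℕ) (i : Fin n) :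
    leverage A v k i
      = ∑ j : Fin d, (if j.val < k then (sv A j ^ 2)⁻¹ else 0) * inner ℝ (rowVec A i) (v j) ^ 2 := by
  rw [leverage, Finset.sum_filter]
  refine Finset.sum_congr rfl fun j _ => ?_
  split_ifs <;> simp [div_eq_inv_mul]

lemma projDist_eq_sub (A : Matrix (Fin n) (Fin d) ℝ)
    (v : OrthonormalBasis (Fin d) ℝ (EuclideanSpace ℝ (Fin d))) (k : ℕ) (i : Fin n) :
    projDist A v k i = ‖rowVec A i‖ ^ 2
      - ∑ j : Fin d, (if j.val < k then 1 else 0) * inner ℝ (rowVec A i) (v j) ^ 2 := by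
  rw [projDist, Finset.sum_filter, ← v.sum_sq_inner_left, ← Finset.sum_sub_distrib]
  refine Finset.sum_congr rfl fun j _ => ?_
  split_ifs <;> first | omega | simp

/-- If the Gram operators of `A` and of `B` differ by at most `η`, at most a fraction of the gap of
`A` at `k`, then so do the scores with respect to singular vectors of `A` and of `B`. -/
lemma score_error_le {A : Matrix (Fin n) (Fin d) ℝ} {B : Matrix (Fin m) (Fin d) ℝ}
    {v b : OrthonormalBasis (Fin d) ℝ (EuclideanSpace ℝ (Fin d))} {k : ℕ} {η g : ℝ}
    {w : ℕ → EuclideanSpace ℝ (Fin d)} (hk : 1 ≤ k) (hkd : k ≤ d)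
    (hv : IsRightSingularBasis A v) (hb : IsRightSingularBasis B b)
    (hw : rowGram w m = (B.transpose * B).toEuclideanLin) (hη : 0 ≤ η)
    (h : ∀ x, ‖rowGram (streamRow A) n x - rowGram w m x‖ ≤ η * ‖x‖)
    (hg : 0 < g) (hgap : g ≤ sv A (k - 1) ^ 2 - sv A k ^ 2) (hηg : 2 * η ≤ g) :
    k ≤ m ∧ ∀ i, |projDist A v k i
          - (scorePair k (sv B) (fun r => if h : r < d then b ⟨r, h⟩ else 0) (rowVec A i)).2|
        ≤ 4 * k * η / g * ‖rowVec A i‖ ^ 2 ∧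
      |leverage A v k i
          - (scorePair k (sv B) (fun r => if h : r < d then b ⟨r, h⟩ else 0) (rowVec A i)).1|
        ≤ 8 * k * η / (sv A (k - 1) ^ 2 * g) * ‖rowVec A i‖ ^ 2 := by
  have hsq : ∀ {p : ℕ} (D : Matrix (Fin p) (Fin d) ℝ) {i j : ℕ}, i ≤ j → sv D j ^ 2 ≤ sv D i ^ 2 :=
    fun D _ _ hij => pow_le_pow_left₀ (sv_nonneg D _) (sv_antitone D hij) 2
  have hv' : ∀ j, rowGram (streamRow A) n (v j) = sv A j ^ 2 • v j := fun j => by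
    rw [rowGram_streamRow]
    exact hv j
  have hb' : ∀ j, rowGram w m (b j) = sv B j ^ 2 • b j := fun j => by
    rw [hw]
    exact hb j
  have hAant : Antitone fun j : Fin d => sv A j ^ 2 := fun i j hij => hsq A hij
  have hBant : Antitone fun j : Fin d => sv B j ^ 2 := fun i j hij => hsq B hij
  have hAB : ∀ j : Fin d, sv A j ^ 2 ≤ sv B j ^ 2 + η :=
    eigenvalue_le_add hv' hb' hAant hBant h
  have hBA : ∀ j : Fin d, sv B j ^ 2 ≤ sv A j ^ 2 + η :=
    eigenvalue_le_add hb' hv' hBant hAant fun x => by rw [norm_sub_rev]; exact h x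
  set α := sv A (k - 1) ^ 2 with hα
  have hgα : g ≤ α := hgap.trans (sub_le_self _ (sq_nonneg _))
  have hα0 : 0 < α := hg.trans_le hgα
  have hBk : α - η ≤ sv B (k - 1) ^ 2 := by
    have := hAB ⟨k - 1, by omega⟩
    simp only at this
    linarith
  have hAlt : ∀ i : Fin d, i.val < k → α ≤ sv A i ^ 2 := fun i hi => hsq A (by omega)
  have hBlt : ∀ i : Fin d, i.val < k → α - η ≤ sv B i ^ 2 := fun i hi =>
    hBk.trans (hsq B (by omega))
  have hAge : ∀ i : Fin d, k ≤ i.val → sv A i ^ 2 ≤ α - g := fun i hi => by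
    have := hsq A hi
    linarith
  have hBge : ∀ i : Fin d, k ≤ i.val → sv B i ^ 2 ≤ α - g + η := fun i hi => by
    have := hBA i
    have := hAge i hi
    linarith
  refine ⟨?_, fun i => ⟨?_, ?_⟩⟩
  -- With fewer than k rows the k-th singular value of B would vanish, against σₖ(B)² ≥ α - η > 0.
  · by_contra! hkm
    rw [sv_eq_zero_of_height_le B (by omega)] at hBk
    norm_num at hBk
    linarith
  · rw [projDist_eq_sub, scorePair_snd hkd, sub_sub_sub_cancel_left, abs_sub_comm]
    -- For indicators only mixed pairs matter; their eigenvalues differ by at least g - η ≥ g/2.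
    refine (abs_sum_sub_sum_le (rowGram_symm _ _) (rowGram_symm _ _) hv' hb' hη h hk
      (K := 2 / g) (by positivity) (fun i hi => if_neg hi.not_gt) (fun i hi => if_neg hi.not_gt)
      ?_ _).trans (le_of_eq (by ring))
    intro i j hij
    rcases lt_or_ge i.val k with hi | hi <;> rcases lt_or_ge j.val k with hj | hj
    · rw [if_pos hi, if_pos hj, sub_self, abs_zero]
      positivity
    · have h1 := hAlt i hi
      have h2 := hBge j hj
      rw [if_pos hi, if_neg hj.not_gt, sub_zero, abs_one, abs_of_nonneg (by linarith),
        div_mul_eq_mul_div,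
        le_div_iff₀ hg]
      linarith
    · have h1 := hBlt j hj
      have h2 := hAge i hi
      rw [if_pos hj, if_neg hi.not_gt, zero_sub, abs_neg, abs_one, abs_sub_comm,
        abs_of_nonneg (by linarith), div_mul_eq_mul_div, le_div_iff₀ hg]
      linarith
    · omega
  · rw [leverage_eq_sum, scorePair_fst hkd]
    -- If both indices are below k, the divided difference of 1/λ is 1/(xy) with xy ≥ α²/2 ≥ αg/4.
    -- For mixed pairs the inverse is at most 2/α and the difference at least g/2, which is where 4
    -- comes from.
    refine (abs_sum_sub_sum_le (rowGram_symm _ _) (rowGram_symm _ _) hv' hb' hη h hk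
      (K := 4 / (α * g)) (by positivity) (fun i hi => if_neg hi.not_gt)
      (fun i hi => if_neg hi.not_gt) ?_ _).trans (le_of_eq (by ring))
    intro i j hij
    rcases lt_or_ge i.val k with hi | hi <;> rcases lt_or_ge j.val k with hj | hj
    · have h1 := hAlt i hi
      have h2 := hBlt j hj
      have hx : 0 < sv A i ^ 2 := by linarith
      have hy : 0 < sv B j ^ 2 := by linarith
      have hxy : α * g / 4 ≤ sv A i ^ 2 * sv B j ^ 2 := by nlinarith
      rw [if_pos hi, if_pos hj, inv_sub_inv hx.ne' hy.ne', abs_div, abs_of_pos (mul_pos hx hy),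
        abs_sub_comm, div_le_iff₀ (mul_pos hx hy), mul_right_comm]
      refine le_mul_of_one_le_left (abs_nonneg _) ?_
      rw [div_mul_eq_mul_div, one_le_div (by positivity)]
      linarith
    · have h1 := hAlt i hi
      have h2 := hBge j hj
      have h3 : (sv A i ^ 2)⁻¹ ≤ α⁻¹ := inv_anti₀ hα0 h1
      rw [if_pos hi, if_neg hj.not_gt, sub_zero, abs_of_nonneg (by positivity),
        abs_of_nonneg (by linarith)]
      refine h3.trans ?_
      rw [div_mul_eq_mul_div, le_div_iff₀ (by positivity), inv_mul_cancel_left₀ hα0.ne']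
      linarith
    · have h1 := hBlt j hj
      have h2 := hAge i hi
      have h3 : (sv B j ^ 2)⁻¹ ≤ (α / 2)⁻¹ := inv_anti₀ (by positivity) (by linarith)
      rw [if_pos hj, if_neg hi.not_gt, zero_sub, abs_neg, abs_of_nonneg (by positivity),
        abs_sub_comm, abs_of_nonneg (by linarith)]
      refine h3.trans ?_
      rw [div_mul_eq_mul_div, le_div_iff₀ (by positivity), inv_div, div_mul_eq_mul_div,
        div_le_iff₀ hα0]
      nlinarith
    · omega

end Scores

/-! ### Choice of the sketch size and conclusion -/

/-- The sketch size, divided by `k²`, as a polynomial in `ε⁻¹`, `κₖ`, `Δ⁻¹`. -/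
noncomputable def sketchPoly : MvPolynomial (Fin 3) ℝ :=
  MvPolynomial.C 800 * (MvPolynomial.X 1 * MvPolynomial.X 2 * (1 + MvPolynomial.X 0))

lemma eval_sketchPoly (x y z : ℝ) :
    MvPolynomial.eval ![x, y, z] sketchPoly = 800 * (y * z * (1 + x)) := by
  simp [sketchPoly]

theorem theorem1 :
    ∃ (p : MvPolynomial (Fin 3) ℝ) (C : ℝ),
      ∀ (n d k : ℕ) (A : Matrix (Fin n) (Fin d) ℝ) (Δ ε : ℝ)
        (v : OrthonormalBasis (Fin d) ℝ (EuclideanSpace ℝ (Fin d))),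
        A ≠ 0 → 1 ≤ k → 0 < Δ → 0 < ε →
        IsSeparated A k Δ → IsApproxLowRank A k → IsRightSingularBasis A v →
        ∃ ℓ : ℕ,
          ℓ = ⌈(k : ℝ) ^ 2 * MvPolynomial.eval ![ε⁻¹, condNum A k, Δ⁻¹] p⌉₊ ∧
          (∃ o, Produces A (twoPassFD n k ℓ) o) ∧
          (∀ o, Produces A (twoPassFD n k ℓ) o →
            ∃ Lt Tt : Fin n → ℝ, o = List.ofFn (fun i => (Lt i, Tt i)) ∧
              ∀ i : Fin n,
                |projDist A v k i - Tt i| ≤ ε * ‖rowVec A i‖ ^ 2 ∧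
                |leverage A v k i - Lt i| ≤ ε * k * (‖rowVec A i‖ ^ 2 / frobSq A)) ∧
          (memory d (twoPassFD n k ℓ) : ℝ) ≤ C * (d * ℓ) ∧
          (runTime d (twoPassFD n k ℓ) : ℝ) ≤ C * (n * d * ℓ) := by
  refine ⟨sketchPoly, 34, ?_⟩
  intro n d k A Δ ε v hA hk hΔ hε hsep hlow hv
  have hn : 1 ≤ n := by
    by_contra! h
    obtain rfl : n = 0 := by omega
    exact hA (Subsingleton.elim _ _)
  have hd : 1 ≤ d := by
    by_contra! h
    obtain rfl : d = 0 := by omega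
    exact hA (by ext i j; exact j.elim0)
  have hs0 : 0 < sv A 0 := sv_zero_pos hA
  rw [IsSeparated] at hsep
  rw [eval_sketchPoly, condNum]
  set s := sv A 0 ^ 2 with hs
  set α := sv A (k - 1) ^ 2 with hα
  have hs' : 0 < s := by positivity
  have hgα : Δ * s ≤ α := hsep.trans (sub_le_self _ (sq_nonneg _))
  have hg : 0 < Δ * s := mul_pos hΔ hs'
  have hα' : 0 < α := hg.trans_le hgα
  have hαs : α ≤ s := pow_le_pow_left₀ (sv_nonneg A _) (sv_antitone A (Nat.zero_le _)) 2
  have hkd : k ≤ d := by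
    by_contra! h
    rw [hα, sv_eq_zero_of_width_le A (by omega)] at hα'
    norm_num at hα'
  have hF : frobSq A ≤ 10 * k * s := by
    have h1 : ∑ j ∈ Finset.range k, sv A j ^ 2 ≤ k * s := by
      refine (Finset.sum_le_card_nsmul _ _ s fun j _ => ?_).trans (le_of_eq (by simp))
      exact pow_le_pow_left₀ (sv_nonneg A _) (sv_antitone A (Nat.zero_le _)) 2
    rw [IsApproxLowRank, ← frobSq_eq_sum_sv] at hlow
    linarith
  have hF0 := frobSq_pos hA
  have hk' : (1 : ℝ) ≤ k := by exact_mod_cast hk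
  -- The summand ε⁻¹ gives the accuracy; the summand 1 keeps η below half the gap and ℓ ≥ k even for
  -- large ε.
  set q := s / α * Δ⁻¹ * (1 + ε⁻¹) with hq
  have hq1 : s / (α * Δ) ≤ q := by
    rw [hq, div_mul_eq_div_div, ← div_eq_mul_inv (s / α)]
    refine le_mul_of_one_le_right (by positivity) ?_
    have := inv_pos.2 hε
    linarith
  have hq2 : s / (α * Δ * ε) ≤ q := by
    rw [hq, div_mul_eq_div_div, div_mul_eq_div_div, ← div_eq_mul_inv (s / α),
      div_eq_mul_inv _ ε]
    exact mul_le_mul_of_nonneg_left (by linarith) (by positivity)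
  have hq0 : 1 ≤ q := by
    refine le_trans ?_ hq1
    rw [one_le_div (by positivity)]
    have : Δ ≤ 1 := by
      by_contra! h
      nlinarith
    nlinarith
  set ℓ := ⌈(k : ℝ) ^ 2 * (800 * q)⌉₊ with hℓdef
  have hℓ : (k : ℝ) ^ 2 * (800 * q) ≤ ℓ := Nat.le_ceil _
  have hkℓ : k ≤ ℓ := by
    have : (k : ℝ) ≤ ℓ := by nlinarith
    exact_mod_cast this
  have hℓ1 : 1 ≤ ℓ := hk.trans hkℓ
  obtain ⟨⟨t, ht⟩, hall⟩ := runs_twoPassFD (A := A) hℓ1 hkℓ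
  refine ⟨ℓ, rfl, ⟨t.out, t, ht, rfl⟩, ?_, ?_, ?_⟩
  · rintro o ⟨t, ht, rfl⟩
    obtain ⟨m, -, B, w, b, ⟨η, hη, herr, hmass⟩, hw, hb, hout⟩ := hall t ht
    -- 800 = 10 · 80: the 10 comes from ‖A‖_F² ≤ 10kσ₁² here, and 80 = 8 · 10 is what the leverage
    -- bound needs, as ‖A‖_F² enters there once more.
    have hη' : 80 * k * q * η ≤ s := by
      have h1 : ℓ * η ≤ 10 * k * s := by
        have := rowMass_nonneg w m
        rw [rowMass_streamRow] at hmass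
        linarith
      have h2 := mul_le_mul_of_nonneg_right hℓ hη
      refine le_of_mul_le_mul_left ?_ (by positivity : (0 : ℝ) < 10 * k)
      nlinarith
    have hη1 : 80 * k * η ≤ α * Δ := by
      have h1 : 80 * k * η * (s / (α * Δ)) ≤ s := by
        have := mul_le_mul_of_nonneg_left hq1 (by positivity : 0 ≤ 80 * k * η)
        linarith
      rw [mul_div_assoc', div_le_iff₀ (by positivity), mul_comm s] at h1
      exact le_of_mul_le_mul_right h1 hs'
    have hη2 : 80 * k * η ≤ α * Δ * ε := by
      have h1 : 80 * k * η * (s / (α * Δ * ε)) ≤ s := by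
        have := mul_le_mul_of_nonneg_left hq2 (by positivity : 0 ≤ 80 * k * η)
        linarith
      rw [mul_div_assoc', div_le_iff₀ (by positivity), mul_comm s] at h1
      exact le_of_mul_le_mul_right h1 hs'
    have hαΔ : α * Δ ≤ Δ * s := by nlinarith
    have hkη : η ≤ k * η := le_mul_of_one_le_left hη hk'
    obtain ⟨hkm, hscore⟩ := score_error_le (g := Δ * s) hk hkd hv hb hw hη herr hg hsep
      (by linarith)
    refine ⟨_, _, hout hkm, fun i => ?_⟩
    obtain ⟨hT, hL⟩ := hscore i
    refine ⟨hT.trans (mul_le_mul_of_nonneg_right ?_ (sq_nonneg _)), hL.trans ?_⟩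
    · rw [div_le_iff₀ hg]
      nlinarith
    · rw [← mul_div_assoc (ε * k), mul_div_right_comm (ε * k)]
      refine mul_le_mul_of_nonneg_right ?_ (sq_nonneg ‖rowVec A i‖)
      rw [← hα, div_le_div_iff₀ (by positivity) hF0]
      calc 8 * k * η * frobSq A ≤ 8 * k * η * (10 * k * s) :=
            mul_le_mul_of_nonneg_left hF (by positivity)
        _ = 80 * k * η * (k * s) := by ring
        _ ≤ α * Δ * ε * (k * s) := mul_le_mul_of_nonneg_right hη2 (by positivity)
        _ = _ := by ring
  · have h1 : memory d (twoPassFD n k ℓ) ≤ 34 * (d * ℓ) :=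
      (memory_twoPassFD_le n k hd hℓ1 hkℓ).trans (Nat.mul_le_mul_right _ (by norm_num))
    exact_mod_cast h1
  · exact_mod_cast runTime_twoPassFD_le hn hd hℓ1 hkℓ
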